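/- Let $M$ be a smooth $n$-dimensional manifold without boundary, $(N,\gamma)$ a smooth Riemannian manifold without boundary, $T\in\mathbb R$ and $J\subseteq(-\infty,T)$ an open set of times. Let $(g(t),\phi(t))_{t\in J}$ be a smooth solution of the harmonic Ricci flow with non-negative differentiable coupling function $\alpha(t)$, i.e. the $g(t)$ are Riemannian metrics on $M$ and the $\phi(t)\colon M\to N$ are maps, both smooth in $(t,x)$, with $$\partial_t g=-2\,\mathrm{Ric}_{g}+2\alpha\,\nabla\phi\otimes\nabla\phi,\qquad \partial_t\phi=\tau_{g}\phi,$$ where $\nabla\phi\otimes\nabla\phi=\phi^*\gamma$ and $\tau_g\phi$ is the tension field of $\phi$. Put $S_{ij}=R_{ij}-\alpha\nabla_i\phi\nabla_j\phi$, let $\hat S=g^{ij}S_{ij}=R-\alpha|\nabla\phi|^2$ be its trace ($R$ the scalar curvature), and let $\square^*=-\partial_t-\Delta+\hat S$, where $\Delta$, $\nabla$ and all norms are those of the evolving metric $g(t)$. Let $l\colon J\times M\to\mathbb R$ be smooth and suppose that $v=(4\pi(T-t))^{-n/2}e^{-l}$ solves the adjoint heat equation $\square^*v=0$ on $J\times M$.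 Define $$w=\big((T-t)(2\Delta l-|\nabla l|^2+\hat S)+l-n\big)v .$$ Then on $J\times M$ $$\square^*w=-2(T-t)\Big[\Big|S_{ij}+\nabla_i\nabla_jl-\frac{g_{ij}}{2(T-t)}\Big|^2+\alpha\,\big|\tau_g\phi-\langle\nabla\phi,\nabla l\rangle\big|^2-\tfrac12\,\dot\alpha\,|\nabla\phi|^2\Big]v .$$ -/

import Mathlib

open scoped Manifold ContDiff Bundle

noncomputable section

namespace HarmonicRicci

/-! ### Tensor calculus in coordinates on `ℝⁿ` -/

/-- The partial derivative `∂ᵢ f`. -/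
def pd {n : ℕ} (i : Fin n) (f : EuclideanSpace ℝ (Fin n) → ℝ) (u : EuclideanSpace ℝ (Fin n)) : ℝ :=
  fderiv ℝ f u (EuclideanSpace.single i 1)

/-- The Christoffel symbol `Γᵏᵢⱼ = ½ gᵏˡ (∂ᵢ gⱼₗ + ∂ⱼ gᵢₗ - ∂ₗ gᵢⱼ)` of the metric with components `G`. -/
def christoffel {n : ℕ} (G : EuclideanSpace ℝ (Fin n) → Matrix (Fin n) (Fin n) ℝ)
    (k i j : Fin n) (u : EuclideanSpace ℝ (Fin n)) : ℝ :=
  (1 / 2) * ∑ l, (G u)⁻¹ k l *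
    (pd i (fun z => G z j l) u + pd j (fun z => G z i l) u - pd l (fun z => G z i j) u)

/-- The components
`Rᵢⱼ = ∂ₖ Γᵏᵢⱼ - ∂ⱼ Γᵏᵢₖ + Γᵏₖₗ Γˡᵢⱼ - Γᵏⱼₗ Γˡᵢₖ` of the Ricci tensor. -/
def ricci {n : ℕ} (G : EuclideanSpace ℝ (Fin n) → Matrix (Fin n) (Fin n) ℝ)
    (u : EuclideanSpace ℝ (Fin n)) : Matrix (Fin n) (Fin n) ℝ :=
  Matrix.of fun i j =>
    ∑ k, (pd k (christoffel G k i j) u - pd j (christoffel G k i k) u)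
      + ∑ k, ∑ l, (christoffel G k k l u * christoffel G l i j u
          - christoffel G k j l u * christoffel G l i k u)

/-- The components `∇ᵢ∇ⱼ f = ∂ᵢ∂ⱼ f - Γᵏᵢⱼ ∂ₖ f` of the Hessian of a function. -/
def hessian {n : ℕ} (G : EuclideanSpace ℝ (Fin n) → Matrix (Fin n) (Fin n) ℝ)
    (f : EuclideanSpace ℝ (Fin n) → ℝ) (u : EuclideanSpace ℝ (Fin n)) :
    Matrix (Fin n) (Fin n) ℝ :=
  Matrix.of fun i j => pd i (pd j f) u - ∑ k, christoffel G k i j u * pd k f u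

/-- The trace `gⁱʲ Aᵢⱼ` of a covariant 2-tensor. -/
def traceWith {n : ℕ} (G A : Matrix (Fin n) (Fin n) ℝ) : ℝ :=
  ∑ i, ∑ j, G⁻¹ i j * A i j

/-- The squared norm `gⁱᵏ gʲˡ Aᵢⱼ Aₖₗ` of a covariant 2-tensor. -/
def tensorNormSq {n : ℕ} (G A : Matrix (Fin n) (Fin n) ℝ) : ℝ :=
  ∑ i, ∑ j, ∑ k, ∑ l, G⁻¹ i k * G⁻¹ j l * A i j * A k l

/-- The pairing `⟨∇f, ∇h⟩ = gⁱʲ ∂ᵢf ∂ⱼh`. -/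
def gradPairing {n : ℕ} (G : EuclideanSpace ℝ (Fin n) → Matrix (Fin n) (Fin n) ℝ)
    (f h : EuclideanSpace ℝ (Fin n) → ℝ) (u : EuclideanSpace ℝ (Fin n)) : ℝ :=
  traceWith (G u) (Matrix.of fun i j => pd i f u * pd j h u)

/-! ### Riemannian metrics, functions and maps on manifolds, in a smooth chart -/

/-- Smooth Riemannian metrics on an `n`-dimensional manifold. -/
abbrev RMetric (n : ℕ) (M : Type*) [TopologicalSpace M] [ChartedSpace (EuclideanSpace ℝ (Fin n)) M]
    [IsManifold (𝓡 n) ∞ M] :=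
  Bundle.ContMDiffRiemannianMetric (𝓡 n) ∞ (EuclideanSpace ℝ (Fin n))
    (fun x : M => TangentSpace (𝓡 n) x)

/-- The smooth charts of an `n`-dimensional manifold. -/
abbrev charts (n : ℕ) (M : Type*) [TopologicalSpace M] [ChartedSpace (EuclideanSpace ℝ (Fin n)) M] :
    Set (OpenPartialHomeomorph M (EuclideanSpace ℝ (Fin n))) :=
  IsManifold.maximalAtlas (𝓡 n) ∞ M

section Chart

variable {n k : ℕ}
  {M : Type*} [TopologicalSpace M] [ChartedSpace (EuclideanSpace ℝ (Fin n)) M]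
  [IsManifold (𝓡 n) ∞ M]
  {N : Type*} [TopologicalSpace N] [ChartedSpace (EuclideanSpace ℝ (Fin k)) N]
  [IsManifold (𝓡 k) ∞ N]

/-- The components `gᵢⱼ = g(∂ᵢ, ∂ⱼ)` of a metric in the chart `e`, as functions of the
coordinates; here `∂ᵢ = d(e⁻¹)(eᵢ)`. -/
def metricIn (g : RMetric n M) (e : OpenPartialHomeomorph M (EuclideanSpace ℝ (Fin n)))
    (u : EuclideanSpace ℝ (Fin n)) : Matrix (Fin n) (Fin n) ℝ :=
  Matrix.of fun i j => g.inner (e.symm u)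
    (mfderiv (𝓡 n) (𝓡 n) e.symm u (EuclideanSpace.single i (1 : ℝ)))
    (mfderiv (𝓡 n) (𝓡 n) e.symm u (EuclideanSpace.single j (1 : ℝ)))

/-- The components in the chart `e` of `∇φ ⊗ ∇φ`, that is, of the pullback `φ^*γ`:
`(∇φ ⊗ ∇φ)ᵢⱼ = γ(dφ(∂ᵢ), dφ(∂ⱼ))`. -/
def pullbackIn (γ : RMetric k N) (φ : M → N)
    (e : OpenPartialHomeomorph M (EuclideanSpace ℝ (Fin n)))
    (u : EuclideanSpace ℝ (Fin n)) : Matrix (Fin n) (Fin n) ℝ :=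
  Matrix.of fun i j => γ.inner (φ (e.symm u))
    (mfderiv (𝓡 n) (𝓡 k) (φ ∘ e.symm) u (EuclideanSpace.single i (1 : ℝ)))
    (mfderiv (𝓡 n) (𝓡 k) (φ ∘ e.symm) u (EuclideanSpace.single j (1 : ℝ)))

/-- The components of the tensor `S = Ric - α ∇φ ⊗ ∇φ` in the chart `e`. -/
def tensorSIn (g : RMetric n M) (γ : RMetric k N) (φ : M → N) (a : ℝ)
    (e : OpenPartialHomeomorph M (EuclideanSpace ℝ (Fin n)))
    (u : EuclideanSpace ℝ (Fin n)) : Matrix (Fin n) (Fin n) ℝ :=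
  ricci (metricIn g e) u - a • pullbackIn γ φ e u

/-- `|∇φ|² = gⁱʲ γ(∂ᵢφ, ∂ⱼφ)` at the point `x`, computed in the chart `e`. -/
def energyIn (g : RMetric n M) (γ : RMetric k N) (φ : M → N)
    (e : OpenPartialHomeomorph M (EuclideanSpace ℝ (Fin n))) (x : M) : ℝ :=
  traceWith (metricIn g e (e x)) (pullbackIn γ φ e (e x))

/-- The Laplace–Beltrami operator at the point `x`, computed in the chart `e`. -/
def laplacianIn (g : RMetric n M) (e : OpenPartialHomeomorph M (EuclideanSpace ℝ (Fin n)))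
    (f : M → ℝ) (x : M) : ℝ :=
  traceWith (metricIn g e (e x)) (hessian (metricIn g e) (f ∘ e.symm) (e x))

/-- The component `φᵃ` of a map, read in the charts `e` of `M` and `e'` of `N`. -/
def mapComp (φ : M → N) (e : OpenPartialHomeomorph M (EuclideanSpace ℝ (Fin n)))
    (e' : OpenPartialHomeomorph N (EuclideanSpace ℝ (Fin k))) (a : Fin k)
    (u : EuclideanSpace ℝ (Fin n)) : ℝ :=
  e' (φ (e.symm u)) a

/-- The components
`(τ_g φ)ᵃ = Δ φᵃ + gⁱʲ Γᵃ_{bc}(φ) ∂ᵢφᵇ ∂ⱼφᶜ` of the tension field at the point `x`,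
where `Γᵃ_{bc}` are the Christoffel symbols of the target. -/
def tensionIn (g : RMetric n M) (γ : RMetric k N) (φ : M → N)
    (e : OpenPartialHomeomorph M (EuclideanSpace ℝ (Fin n)))
    (e' : OpenPartialHomeomorph N (EuclideanSpace ℝ (Fin k))) (x : M) (a : Fin k) : ℝ :=
  traceWith (metricIn g e (e x)) (hessian (metricIn g e) (mapComp φ e e' a) (e x))
    + ∑ b, ∑ c, christoffel (metricIn γ e') a b c (e' (φ x)) *
        gradPairing (metricIn g e) (mapComp φ e e' b) (mapComp φ e e' c) (e x)

/-! ### Scalar functions on the manifold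

The following scalars do not depend on the chart; they are computed at `x` in the
preferred chart at `x`. -/

/-- The Laplacian `Δ f` as a function on `M`. -/
def laplacian (g : RMetric n M) (f : M → ℝ) (x : M) : ℝ :=
  laplacianIn g (chartAt (EuclideanSpace ℝ (Fin n)) x) f x

/-- `|∇f|²` as a function on `M`. -/
def gradSq (g : RMetric n M) (f : M → ℝ) (x : M) : ℝ :=
  gradPairing (metricIn g (chartAt (EuclideanSpace ℝ (Fin n)) x))
    (f ∘ (chartAt (EuclideanSpace ℝ (Fin n)) x).symm)
    (f ∘ (chartAt (EuclideanSpace ℝ (Fin n)) x).symm) (chartAt (EuclideanSpace ℝ (Fin n)) x x)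

/-- The trace of `S`, i.e. the scalar curvature minus `α |∇φ|²`, as a function on `M`. -/
def traceS (g : RMetric n M) (γ : RMetric k N) (φ : M → N) (a : ℝ) (x : M) : ℝ :=
  traceWith (metricIn g (chartAt (EuclideanSpace ℝ (Fin n)) x)
      (chartAt (EuclideanSpace ℝ (Fin n)) x x))
    (tensorSIn g γ φ a (chartAt (EuclideanSpace ℝ (Fin n)) x)
      (chartAt (EuclideanSpace ℝ (Fin n)) x x))

/-! ### The flow and the adjoint heat operator -/

/-- `(g(t), φ(t))`, `t ∈ J`, is a smooth solution of the harmonic Ricci flow with coupling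
function `α`:
`∂ₜ g = -2 Ric + 2 α ∇φ ⊗ ∇φ` and `∂ₜ φ = τ_g φ`, in all smooth charts. -/
structure IsHarmonicRicciFlow (J : Set ℝ) (g : ℝ → RMetric n M) (γ : RMetric k N)
    (φ : ℝ → M → N) (α : ℝ → ℝ) : Prop where
  metric_smooth : ∀ e ∈ charts n M, ∀ i j : Fin n,
    ContDiffOn ℝ ∞ (fun p : ℝ × EuclideanSpace ℝ (Fin n) => metricIn (g p.1) e p.2 i j)
      (J ×ˢ e.target)
  map_smooth : ContMDiffOn (𝓘(ℝ, ℝ).prod (𝓡 n)) (𝓡 k) ∞ (fun p : ℝ × M => φ p.1 p.2)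
    (J ×ˢ Set.univ)
  coupling_differentiable : DifferentiableOn ℝ α J
  coupling_nonneg : ∀ t ∈ J, 0 ≤ α t
  metric_eq : ∀ t ∈ J, ∀ e ∈ charts n M, ∀ u ∈ e.target, ∀ i j : Fin n,
    deriv (fun s => metricIn (g s) e u i j) t =
      -2 * ricci (metricIn (g t) e) u i j + 2 * α t * pullbackIn γ (φ t) e u i j
  map_eq : ∀ t ∈ J, ∀ e ∈ charts n M, ∀ e' ∈ charts k N, ∀ x ∈ e.source,
    φ t x ∈ e'.source → ∀ a : Fin k,
      deriv (fun s => e' (φ s x) a) t = tensionIn (g t) γ (φ t) e e' x a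

/-- The adjoint heat operator `□^* f = -∂ₜ f - Δ f + (tr S) f` along the flow, with the
Laplacian computed in the chart `e`. -/
def adjointHeatIn (g : ℝ → RMetric n M) (γ : RMetric k N) (φ : ℝ → M → N) (α : ℝ → ℝ)
    (e : OpenPartialHomeomorph M (EuclideanSpace ℝ (Fin n))) (f : ℝ → M → ℝ)
    (t : ℝ) (x : M) : ℝ :=
  -deriv (fun s => f s x) t - laplacianIn (g t) e (f t) x
    + traceS (g t) γ (φ t) (α t) x * f t x

/-- `|S + Hess l - g / (2 (T - t))|²` at `x`, computed in the chart `e`; `σ` stands for `T - t`. -/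
def solitonTensorSq (g : RMetric n M) (γ : RMetric k N) (φ : M → N) (a : ℝ) (l : M → ℝ) (σ : ℝ)
    (e : OpenPartialHomeomorph M (EuclideanSpace ℝ (Fin n))) (x : M) : ℝ :=
  tensorNormSq (metricIn g e (e x))
    (tensorSIn g γ φ a e (e x) + hessian (metricIn g e) (l ∘ e.symm) (e x)
      - (1 / (2 * σ)) • metricIn g e (e x))

/-- `|τ_g φ - ⟨∇φ, ∇l⟩|²` at `x`, the norm being that of `γ` at `φ(x)`, computed in the charts
`e` and `e'`. -/
def solitonMapSq (g : RMetric n M) (γ : RMetric k N) (φ : M → N) (l : M → ℝ)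
    (e : OpenPartialHomeomorph M (EuclideanSpace ℝ (Fin n)))
    (e' : OpenPartialHomeomorph N (EuclideanSpace ℝ (Fin k))) (x : M) : ℝ :=
  ∑ a, ∑ b, metricIn γ e' (e' (φ x)) a b *
    (tensionIn g γ φ e e' x a
      - gradPairing (metricIn g e) (mapComp φ e e' a) (l ∘ e.symm) (e x)) *
    (tensionIn g γ φ e e' x b
      - gradPairing (metricIn g e) (mapComp φ e e' b) (l ∘ e.symm) (e x))

/-- `v = (4π(T-t))^{-n/2} e^{-l}`; `n` is the dimension. -/
def kernelOf (n : ℕ) (T : ℝ) (l : ℝ → M → ℝ) (t : ℝ) (x : M) : ℝ :=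
  (4 * Real.pi * (T - t)) ^ (-(n : ℝ) / 2) * Real.exp (-l t x)

/-- `w = ((T-t)(2Δl - |∇l|² + tr S) + l - n) v`. -/
def harnackOf (T : ℝ) (g : ℝ → RMetric n M) (γ : RMetric k N) (φ : ℝ → M → N) (α : ℝ → ℝ)
    (l : ℝ → M → ℝ) (t : ℝ) (x : M) : ℝ :=
  ((T - t) * (2 * laplacian (g t) (l t) x - gradSq (g t) (l t) x + traceS (g t) γ (φ t) (α t) x)
    + l t x - n) * kernelOf n T l t x

end Chart

end HarmonicRicci

end

open HarmonicRicci

/-!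
In a chart, the smooth functions on an open set of space-time form a ring with commuting
derivations, and Riemannian geometry becomes algebra over that ring. There the equation for `v` says
`∂ₜl = Δl - Q + n/(2σ)`, where `Q = 2Δl - |∇l|² + tr S` and `σ = T - t`. The evolution equations of
`Δ`, `|∇l|²` and `tr S` along the flow, the contracted Bianchi identity and Bochner's formula give
`(∂ₜ + Δ - 2∇l·∇) Q = 2|S + ∇²l|² + 2α|τφ - ⟨∇φ, ∇l⟩|² - α'|∇φ|²`. As `□*v = 0`, the operator `□*`
acts on `w = (σQ + l - n) v` through this equation, and `l - n` completes the first square to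
`|S + ∇²l - g/(2σ)|²`.

The coupling function is only differentiable, so it is replaced near a time `t` by its Taylor
polynomial of order one; the flow equations then survive on the time slice at `t` only, which is
enough, since they are never differentiated in time.
-/

noncomputable section

namespace HarmonicRicci

/-! ### Tensor calculus over a ring with commuting derivations -/

section MatrixDerivation

variable {ι R A : Type*} [CommRing R] [CommRing A] [Algebra R A]

lemma map_matrix_mul [Fintype ι] (d : Derivation R A A) (M N : Matrix ι ι A) :
    (M * N).map d = M.map d * N + M * N.map d := by
  ext i j
  simp only [Matrix.map_apply, Matrix.mul_apply, map_sum, Derivation.leibniz, smul_eq_mul,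
    Matrix.add_apply, ← Finset.sum_add_distrib]
  exact Finset.sum_congr rfl fun k _ => by ring

lemma map_matrix_trace [Fintype ι] (d : Derivation R A A) (M : Matrix ι ι A) :
    d M.trace = (M.map d).trace := by
  simp only [Matrix.trace, Matrix.diag_apply, map_sum, Matrix.map_apply]

lemma map_matrix_comm {d d' : Derivation R A A} (h : ∀ a, d (d' a) = d' (d a))
    (M : Matrix ι ι A) : (M.map d').map d = (M.map d).map d' :=
  Matrix.ext fun i j => h (M i j)

lemma map_matrix_inv [Fintype ι] [DecidableEq ι] (d : Derivation R A A) {M : Matrix ι ι A}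
    (hM : IsUnit M.det) : M⁻¹.map d = -(M⁻¹ * M.map d * M⁻¹) := by
  have leibniz : M⁻¹.map d * M + M⁻¹ * M.map d = 0 := by
    rw [← map_matrix_mul, Matrix.nonsing_inv_mul M hM]
    ext i j
    by_cases h : i = j <;> simp [h]
  calc M⁻¹.map d = M⁻¹.map d * M * M⁻¹ := by rw [Matrix.mul_nonsing_inv_cancel_right _ _ hM]
    _ = -(M⁻¹ * M.map d * M⁻¹) := by rw [eq_neg_of_add_eq_zero_left leibniz, neg_mul]

lemma map_dotProduct [Fintype ι] (d : Derivation R A A) (v w : ι → A) :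
    d (v ⬝ᵥ w) = (d ∘ v) ⬝ᵥ w + v ⬝ᵥ (d ∘ w) := by
  simp only [dotProduct, map_sum, Derivation.leibniz, smul_eq_mul, Function.comp_apply,
    ← Finset.sum_add_distrib]
  exact Finset.sum_congr rfl fun i _ => by ring

lemma comp_mulVec [Fintype ι] (d : Derivation R A A) (M : Matrix ι ι A) (v : ι → A) :
    d ∘ M.mulVec v = (M.map d).mulVec v + M.mulVec (d ∘ v) :=
  funext fun i => map_dotProduct d (M i) v

end MatrixDerivation

/-- A Riemannian metric in coordinates, in algebraic form: `A` plays the role of the ring of smooth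
functions, the commuting derivations `D i` that of the partial derivatives, and `g` is the matrix
of components of the metric. Invertibility of `g` stands in for positivity. -/
structure CoordMetric (ι A : Type*) [Fintype ι] [DecidableEq ι] [CommRing A] [Algebra ℝ A] where
  D : ι → Derivation ℝ A A
  g : Matrix ι ι A
  D_comm : ∀ i j a, D i (D j a) = D j (D i a)
  g_symm : g.IsSymm
  isUnit_det : IsUnit g.det

namespace CoordMetric

variable {ι A : Type*} [Fintype ι] [DecidableEq ι] [CommRing A] [Algebra ℝ A]
  (X : CoordMetric ι A)

/-- The Christoffel symbols of the first kind, `½ (∂ᵢ gⱼₗ + ∂ⱼ gᵢₗ - ∂ₗ gᵢⱼ)`. -/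
def Γlow (i : ι) : Matrix ι ι A := Matrix.of fun l j =>
  (1 / 2 : ℝ) • (X.D i (X.g j l) + X.D j (X.g i l) - X.D l (X.g i j))

/-- The matrix of the Levi-Civita connection in the direction `i`: the Christoffel symbol `Γᵏᵢⱼ`
is `Γ i k j`. -/
def Γ (i : ι) : Matrix ι ι A := X.g⁻¹ * X.Γlow i

/-- The trace `gⁱʲ Tᵢⱼ`. -/
def tr (T : ι → ι → A) : A := ∑ i, ∑ j, X.g⁻¹ i j * T i j

/-- The covariant derivative `∇ₘ aᵢ` of a one-form. -/
def cov1 (a : ι → A) (m i : ι) : A := X.D m (a i) - ∑ k, X.Γ m k i * a k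

/-- The covariant derivative `∇ₘ Tᵢⱼ` of a covariant 2-tensor. -/
def cov2 (T : ι → ι → A) (m i j : ι) : A :=
  X.D m (T i j) - ∑ k, X.Γ m k i * T k j - ∑ k, X.Γ m k j * T i k

/-- The covariant derivative `∇ₘ Tₚᵢⱼ` of a covariant 3-tensor. -/
def cov3 (T : ι → ι → ι → A) (m p i j : ι) : A :=
  X.D m (T p i j) - ∑ k, X.Γ m k p * T k i j - ∑ k, X.Γ m k i * T p k j
    - ∑ k, X.Γ m k j * T p i k

/-- The covariant derivative `∇ₘ Tₚᵢₖⱼ` of a covariant 4-tensor. -/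
def cov4 (T : ι → ι → ι → ι → A) (m p i k j : ι) : A :=
  X.D m (T p i k j) - ∑ s, X.Γ m s p * T s i k j - ∑ s, X.Γ m s i * T p s k j
    - ∑ s, X.Γ m s k * T p i s j - ∑ s, X.Γ m s j * T p i k s

/-- The gradient of `f`, as the one-form `∂ᵢ f`. -/
def grad (f : A) (i : ι) : A := X.D i f

/-- The Hessian `∇ᵢ∇ⱼ f`. -/
def hess (f : A) : ι → ι → A := X.cov1 (X.grad f)

/-- The Laplacian `gⁱʲ ∇ᵢ∇ⱼ f`. -/
def lap (f : A) : A := X.tr (X.hess f)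

/-- The pairing `gⁱʲ aᵢ bⱼ` of two one-forms. -/
def pair (a b : ι → A) : A := X.tr fun i j => a i * b j

/-- The pairing `⟨S, T⟩ = gⁱᵏ gʲˡ Sᵢⱼ Tₖₗ`. -/
def pair2 (S T : ι → ι → A) : A := X.tr fun i k => X.tr fun j l => S i j * T k l

/-- The divergence `gⁱʲ ∇ᵢ aⱼ` of a one-form. -/
def div1 (a : ι → A) : A := X.tr (X.cov1 a)

/-- The divergence `gᵐⁱ ∇ₘ Tᵢⱼ` of a covariant 2-tensor. -/
def div2 (T : ι → ι → A) (j : ι) : A := X.tr fun m i => X.cov2 T m i j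

variable {X}

lemma g_comm (i j : ι) : X.g i j = X.g j i := X.g_symm.apply j i

lemma inv_symm : X.g⁻¹.transpose = X.g⁻¹ := by rw [Matrix.transpose_nonsing_inv, X.g_symm]

lemma inv_comm (i j : ι) : X.g⁻¹ i j = X.g⁻¹ j i := congrFun (congrFun inv_symm j) i

lemma inv_mul_g : X.g⁻¹ * X.g = 1 := Matrix.nonsing_inv_mul X.g X.isUnit_det

lemma g_mul_inv : X.g * X.g⁻¹ = 1 := Matrix.mul_nonsing_inv X.g X.isUnit_det

lemma g_mul_Γ (i : ι) : X.g * X.Γ i = X.Γlow i := by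
  rw [Γ, ← Matrix.mul_assoc, g_mul_inv, Matrix.one_mul]

lemma Γ_symm (i j k : ι) : X.Γ i k j = X.Γ j k i := by
  simp only [Γ, Γlow, Matrix.mul_apply, Matrix.of_apply]
  exact Finset.sum_congr rfl fun l _ => by rw [g_comm i j, add_comm (X.D i _)]

lemma map_D_g (m : ι) : X.g.map (X.D m) = (X.Γ m).transpose * X.g + X.g * X.Γ m := by
  have lowered : (X.Γ m).transpose * X.g = (X.Γlow m).transpose := by
    rw [← g_mul_Γ, Matrix.transpose_mul, X.g_symm]
  ext i j
  rw [lowered, g_mul_Γ]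
  simp only [Γlow, Matrix.map_apply, Matrix.add_apply, Matrix.transpose_apply, Matrix.of_apply,
    g_comm j i, g_comm m i, g_comm m j]
  module

lemma map_D_inv (m : ι) :
    X.g⁻¹.map (X.D m) = -(X.g⁻¹ * (X.Γ m).transpose) - X.Γ m * X.g⁻¹ := by
  rw [map_matrix_inv (X.D m) X.isUnit_det, map_D_g, Matrix.mul_add, Matrix.add_mul,
    ← Matrix.mul_assoc, ← Matrix.mul_assoc, inv_mul_g, Matrix.one_mul,
    Matrix.mul_assoc _ X.g, g_mul_inv, Matrix.mul_one, neg_add']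

lemma tr_add (S T : ι → ι → A) :
    X.tr (fun i j => S i j + T i j) = X.tr S + X.tr T := by
  simp only [tr, mul_add, Finset.sum_add_distrib]

lemma tr_sub (S T : ι → ι → A) :
    X.tr (fun i j => S i j - T i j) = X.tr S - X.tr T := by
  simp only [tr, mul_sub, Finset.sum_sub_distrib]

lemma tr_mul_left (c : A) (T : ι → ι → A) : X.tr (fun i j => c * T i j) = c * X.tr T := by
  simp only [tr, Finset.mul_sum, mul_left_comm c]

lemma tr_mul_right (c : A) (T : ι → ι → A) : X.tr (fun i j => T i j * c) = X.tr T * c := by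
  simp only [tr, Finset.sum_mul, mul_assoc]

lemma tr_sum {κ : Type*} (s : Finset κ) (T : κ → ι → ι → A) :
    X.tr (fun i j => ∑ k ∈ s, T k i j) = ∑ k ∈ s, X.tr (T k) := by
  simp only [tr, Finset.mul_sum]
  rw [Finset.sum_congr rfl fun i _ => Finset.sum_comm, Finset.sum_comm]

lemma sum_mul_tr {κ : Type*} (s : Finset κ) (c : κ → A) (T : κ → ι → ι → A) :
    ∑ k ∈ s, c k * X.tr (T k) = X.tr (fun i j => ∑ k ∈ s, c k * T k i j) := by
  rw [tr_sum]
  exact Finset.sum_congr rfl fun k _ => (tr_mul_left _ _).symm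

lemma tr_symm (T : ι → ι → A) : X.tr (fun i j => T j i) = X.tr T := by
  rw [tr, Finset.sum_comm]
  simp only [tr, fun i j => inv_comm (X := X) j i]

lemma tr_tr (T : ι → ι → ι → ι → A) :
    X.tr (fun i j => X.tr fun k l => T i j k l) = X.tr (fun k l => X.tr fun i j => T i j k l) := by
  rw [tr]
  simp only [← tr_mul_left, ← tr_sum, ← tr.eq_1]

lemma tr_congr {S T : ι → ι → A} (h : ∀ i j, S i j = T i j) : X.tr S = X.tr T := by
  rw [funext₂ h]

lemma tr_eq_trace (T : ι → ι → A) : X.tr T = (X.g⁻¹ * Matrix.of T).trace := by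
  rw [← tr_symm]
  simp only [tr, Matrix.trace, Matrix.diag_apply, Matrix.mul_apply, Matrix.of_apply]

lemma of_cov2 (T : ι → ι → A) (m : ι) : Matrix.of (X.cov2 T m) =
    (Matrix.of T).map (X.D m) - (X.Γ m).transpose * Matrix.of T - Matrix.of T * X.Γ m := by
  ext i j
  simp only [cov2, Matrix.sub_apply, Matrix.map_apply, Matrix.mul_apply, Matrix.transpose_apply,
    Matrix.of_apply, mul_comm (T i _)]

lemma D_tr (m : ι) (T : ι → ι → A) : X.D m (X.tr T) = X.tr (X.cov2 T m) := by
  have cyclic : (X.Γ m * (X.g⁻¹ * Matrix.of T)).trace =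
      (X.g⁻¹ * (Matrix.of T * X.Γ m)).trace := by
    rw [Matrix.trace_mul_comm, Matrix.mul_assoc]
  rw [tr_eq_trace, tr_eq_trace, of_cov2, map_matrix_trace, map_matrix_mul, map_D_inv]
  simp only [Matrix.sub_mul, Matrix.neg_mul, Matrix.mul_sub, Matrix.trace_add,
    Matrix.trace_sub, Matrix.trace_neg, Matrix.mul_assoc, cyclic]
  ring

lemma cov2_mul (a b : ι → A) (m i j : ι) :
    X.cov2 (fun i j => a i * b j) m i j = X.cov1 a m i * b j + a i * X.cov1 b m j := by
  simp only [cov2, cov1, Derivation.leibniz, smul_eq_mul, sub_mul, mul_sub, Finset.sum_mul,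
    Finset.mul_sum, mul_assoc, mul_left_comm]
  ring

lemma D_pair (m : ι) (a b : ι → A) :
    X.D m (X.pair a b) = X.pair (X.cov1 a m) b + X.pair a (X.cov1 b m) := by
  simp only [pair, D_tr, ← tr_add]
  exact tr_congr fun i j => cov2_mul a b m i j

lemma cov1_tr (T : ι → ι → ι → A) (m p : ι) :
    X.cov1 (fun p => X.tr (T p)) m p = X.tr fun i j => X.cov3 T m p i j := by
  simp only [cov1, D_tr, sum_mul_tr, ← tr_sub]
  exact tr_congr fun i j => by simp only [cov2, cov3]; ring

lemma cov2_tr (T : ι → ι → ι → ι → A) (m i j : ι) :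
    X.cov2 (fun i j => X.tr fun p k => T p i k j) m i j =
      X.tr fun p k => X.cov4 T m p i k j := by
  simp only [cov2, D_tr, sum_mul_tr, ← tr_sub]
  exact tr_congr fun p k => by simp only [cov4]; ring

lemma cov3_mul (T : ι → ι → A) (a : ι → A) (m p i j : ι) :
    X.cov3 (fun p i j => T p i * a j) m p i j =
      X.cov2 T m p i * a j + T p i * X.cov1 a m j := by
  simp only [cov3, cov2, cov1, Derivation.leibniz, smul_eq_mul, sub_mul, mul_sub, Finset.sum_mul,
    Finset.mul_sum, mul_assoc, mul_left_comm]
  ring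

lemma cov2_symm {T : ι → ι → A} (h : ∀ i j, T i j = T j i) (m i j : ι) :
    X.cov2 T m i j = X.cov2 T m j i := by
  simp only [cov2, h i]
  rw [sub_right_comm]
  simp only [h j]

lemma hess_symm (f : A) (i j : ι) : X.hess f i j = X.hess f j i := by
  simp only [hess, cov1, grad, X.D_comm i j, X.Γ_symm i j]

lemma pair_eq_dotProduct (a b : ι → A) : X.pair a b = (X.g⁻¹.mulVec a) ⬝ᵥ b := by
  rw [pair, ← tr_symm]
  simp only [tr, dotProduct, Matrix.mulVec, Finset.sum_mul, mul_assoc]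

lemma pair_g_mulVec (c a : ι → A) : X.pair (X.g.mulVec c) a = c ⬝ᵥ a := by
  rw [pair_eq_dotProduct, Matrix.mulVec_mulVec, inv_mul_g, Matrix.one_mulVec]

lemma pair_g (a : ι → A) (p : ι) : X.pair (X.g p) a = a p := by
  have column : X.g p = X.g.mulVec (Pi.single p 1) := by
    ext i
    rw [Matrix.mulVec_single_one, Matrix.col_apply, g_comm]
  rw [column, pair_g_mulVec, single_one_dotProduct]

lemma pair_comm (a b : ι → A) : X.pair a b = X.pair b a := by
  rw [pair, ← tr_symm]
  exact tr_congr fun i j => mul_comm _ _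

lemma pair_add_left (a a' b : ι → A) : X.pair (a + a') b = X.pair a b + X.pair a' b := by
  simp only [pair, Pi.add_apply, add_mul, tr_add]

lemma pair_smul_left (c : A) (a b : ι → A) : X.pair (c • a) b = c * X.pair a b := by
  simp only [pair, Pi.smul_apply, smul_eq_mul, mul_assoc, tr_mul_left]

lemma pair_zero_left (b : ι → A) : X.pair 0 b = 0 := by
  simp only [pair, tr, Pi.zero_apply, zero_mul, mul_zero, Finset.sum_const_zero]

lemma pair_neg_left (a b : ι → A) : X.pair (-a) b = -X.pair a b := by
  rw [← neg_one_smul A a, pair_smul_left, neg_one_mul]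

lemma pair_sub_left (a a' b : ι → A) : X.pair (a - a') b = X.pair a b - X.pair a' b := by
  rw [sub_eq_add_neg, pair_add_left, pair_neg_left, sub_eq_add_neg]

lemma pair2_comm (S T : ι → ι → A) : X.pair2 S T = X.pair2 T S := by
  rw [pair2, ← tr_symm]
  refine tr_congr fun i k => ?_
  rw [← tr_symm]
  exact tr_congr fun j l => mul_comm _ _

lemma pair2_add_left (S S' T : ι → ι → A) :
    X.pair2 (S + S') T = X.pair2 S T + X.pair2 S' T := by
  simp only [pair2, Pi.add_apply, add_mul, tr_add]

lemma pair2_smul_left (c : A) (S T : ι → ι → A) : X.pair2 (c • S) T = c * X.pair2 S T := by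
  simp only [pair2, Pi.smul_apply, smul_eq_mul, mul_assoc, tr_mul_left]

lemma pair2_sub_left (S S' T : ι → ι → A) :
    X.pair2 (S - S') T = X.pair2 S T - X.pair2 S' T := by
  simp only [pair2, Pi.sub_apply, sub_mul, tr_sub]

lemma pair2_g (T : ι → ι → A) : X.pair2 (fun i j => X.g i j) T = X.tr T := by
  rw [pair2, ← tr_symm T]
  exact tr_congr fun i k => pair_g (T k) i

lemma tr_g : X.tr (fun i j => X.g i j) = Fintype.card ι := by
  rw [tr_eq_trace, ← Matrix.trace_one, ← inv_mul_g]
  rfl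

lemma cov1_add (a b : ι → A) : X.cov1 (a + b) = X.cov1 a + X.cov1 b := by
  ext m i
  simp only [cov1, Pi.add_apply, map_add, mul_add, Finset.sum_add_distrib]
  ring

lemma cov1_smul (c : A) (a : ι → A) (m i : ι) :
    X.cov1 (c • a) m i = c * X.cov1 a m i + X.grad c m * a i := by
  simp only [cov1, grad, Pi.smul_apply, smul_eq_mul, Derivation.leibniz, mul_sub, Finset.mul_sum,
    mul_left_comm _ c]
  ring

lemma div1_add (a b : ι → A) : X.div1 (a + b) = X.div1 a + X.div1 b := by
  rw [div1, cov1_add]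
  exact tr_add _ _

lemma div1_smul (c : A) (a : ι → A) : X.div1 (c • a) = c * X.div1 a + X.pair (X.grad c) a := by
  rw [div1, div1, pair, ← tr_mul_left, ← tr_add]
  exact tr_congr (cov1_smul c a)

lemma div1_neg (a : ι → A) : X.div1 (-a) = -X.div1 a := by
  rw [eq_neg_iff_add_eq_zero, ← div1_add, neg_add_cancel]
  simp only [div1, tr, cov1, Pi.zero_apply, map_zero, mul_zero, Finset.sum_const_zero, sub_zero]

lemma div1_sub (a b : ι → A) : X.div1 (a - b) = X.div1 a - X.div1 b := by
  rw [sub_eq_add_neg, div1_add, div1_neg, sub_eq_add_neg]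

lemma grad_add (a b : A) : X.grad (a + b) = X.grad a + X.grad b :=
  funext fun i => map_add (X.D i) a b

lemma grad_sub (a b : A) : X.grad (a - b) = X.grad a - X.grad b :=
  funext fun i => map_sub (X.D i) a b

lemma grad_neg (a : A) : X.grad (-a) = -X.grad a :=
  funext fun i => map_neg (X.D i) a

lemma grad_mul (a b : A) : X.grad (a * b) = a • X.grad b + b • X.grad a :=
  funext fun i => (X.D i).leibniz a b

lemma grad_two : X.grad 2 = 0 := funext fun i => (X.D i).map_natCast 2

lemma lap_eq_div1 (f : A) : X.lap f = X.div1 (X.grad f) := rfl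

lemma lap_add (a b : A) : X.lap (a + b) = X.lap a + X.lap b := by
  rw [lap_eq_div1, grad_add, div1_add, ← lap_eq_div1, ← lap_eq_div1]

lemma lap_neg (a : A) : X.lap (-a) = -X.lap a := by
  rw [lap_eq_div1, grad_neg, div1_neg, ← lap_eq_div1]

lemma lap_sub (a b : A) : X.lap (a - b) = X.lap a - X.lap b := by
  rw [sub_eq_add_neg, lap_add, lap_neg, sub_eq_add_neg]

lemma lap_mul (a b : A) :
    X.lap (a * b) = a * X.lap b + b * X.lap a + 2 * X.pair (X.grad a) (X.grad b) := by
  rw [lap_eq_div1, grad_mul, div1_add, div1_smul, div1_smul, ← lap_eq_div1, ← lap_eq_div1,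
    pair_comm (X.grad b)]
  ring

lemma lap_of_grad_eq_zero {c : A} (hc : X.grad c = 0) : X.lap c = 0 := by
  rw [lap_eq_div1, hc, ← sub_self 0, div1_sub, sub_self]

end CoordMetric

namespace CoordMetric

/-! ### Curvature and the contracted Bianchi identity -/

variable {ι A : Type*} [Fintype ι] [DecidableEq ι] [CommRing A] [Algebra ℝ A]
  (X : CoordMetric ι A)

/-- The curvature endomorphism `[∇ₖ, ∇ⱼ]` on vector fields. -/
def curv (k j : ι) : Matrix ι ι A :=
  (X.Γ j).map (X.D k) - (X.Γ k).map (X.D j) + X.Γ k * X.Γ j - X.Γ j * X.Γ k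

/-- The covariant derivative `∇ₘ M` of an endomorphism field. -/
def covEnd (M : Matrix ι ι A) (m : ι) : Matrix ι ι A :=
  M.map (X.D m) + X.Γ m * M - M * X.Γ m

/-- The curvature tensor `g(∂ₚ, [∇ₖ, ∇ⱼ] ∂ᵢ)`, with all indices lowered. -/
def rm (p i k j : ι) : A := (X.g * X.curv k j) p i

/-- The Ricci tensor. -/
def ric (i j : ι) : A := ∑ k, X.curv k j k i

variable {X}

lemma curv_swap (k j : ι) : X.curv k j = -X.curv j k := by
  simp only [curv]; noncomm_ring

lemma rm_swap_right (p i k j : ι) : X.rm p i k j = -X.rm p i j k := by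
  rw [rm, curv_swap, Matrix.mul_neg, Matrix.neg_apply, rm]

/-- Metric compatibility makes the commutator of covariant derivatives annihilate `g`. -/
lemma curv_transpose_mul_g (k j : ι) : (X.curv k j).transpose * X.g = -(X.g * X.curv k j) := by
  have comm := map_matrix_comm (X.D_comm k j) X.g
  simp only [map_D_g, Matrix.map_add _ (map_add _), map_matrix_mul, Matrix.transpose_map] at comm
  rw [eq_neg_iff_add_eq_zero, ← sub_eq_zero.mpr comm]
  simp only [curv, Matrix.transpose_add, Matrix.transpose_sub, Matrix.transpose_mul,
    ← Matrix.transpose_map]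
  noncomm_ring

lemma rm_swap_left (p i k j : ι) : X.rm p i k j = -X.rm i p k j := by
  have transposed : (X.curv k j).transpose * X.g = (X.g * X.curv k j).transpose := by
    rw [Matrix.transpose_mul, X.g_symm]
  rw [rm, ← Matrix.transpose_apply (X.g * _), ← transposed, curv_transpose_mul_g,
    Matrix.neg_apply, rm]

lemma ric_eq_tr (i j : ι) : X.ric i j = X.tr fun p k => X.rm p i k j := by
  rw [← tr_symm]
  refine Finset.sum_congr rfl fun k _ => ?_
  rw [← Matrix.one_mul (X.curv k j), ← inv_mul_g, Matrix.mul_assoc, Matrix.mul_apply]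
  rfl

lemma covEnd_curv_cyclic (m k j : ι) :
    X.covEnd (X.curv k j) m + X.covEnd (X.curv j m) k + X.covEnd (X.curv m k) j = 0 := by
  simp only [covEnd, curv, Matrix.map_add _ (map_add _), Matrix.map_sub _ (map_sub _),
    map_matrix_mul]
  rw [map_matrix_comm (X.D_comm m k) (X.Γ j), map_matrix_comm (X.D_comm m j) (X.Γ k),
    map_matrix_comm (X.D_comm k j) (X.Γ m)]
  noncomm_ring

lemma g_mul_covEnd (M : Matrix ι ι A) (m : ι) : X.g * X.covEnd M m =
    (X.g * M).map (X.D m) - (X.Γ m).transpose * (X.g * M) - X.g * M * X.Γ m := by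
  rw [covEnd, map_matrix_mul, map_D_g]; noncomm_ring

lemma cov4_rm (m p i k j : ι) : X.cov4 X.rm m p i k j = (X.g * X.covEnd (X.curv k j) m) p i
    - ∑ s, X.Γ m s k * X.rm p i s j - ∑ s, X.Γ m s j * X.rm p i k s := by
  rw [g_mul_covEnd, Matrix.sub_apply, Matrix.sub_apply, Matrix.mul_apply,
    Matrix.mul_apply (M := X.g * X.curv k j)]
  simp only [cov4, rm, Matrix.map_apply, Matrix.transpose_apply, mul_comm (X.Γ m _ i)]

theorem second_bianchi (m p i k j : ι) :
    X.cov4 X.rm m p i k j + X.cov4 X.rm k p i j m + X.cov4 X.rm j p i m k = 0 := by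
  have cyclic : (X.g * (X.covEnd (X.curv k j) m + X.covEnd (X.curv j m) k
      + X.covEnd (X.curv m k) j)) p i = 0 := by
    rw [covEnd_curv_cyclic, Matrix.mul_zero, Matrix.zero_apply]
  simp only [Matrix.mul_add, Matrix.add_apply] at cyclic
  simp only [cov4_rm, rm_swap_right p i j, rm_swap_right p i m, rm_swap_right p i k,
    Γ_symm (X := X) k m, Γ_symm (X := X) j m, Γ_symm (X := X) j k, mul_neg, Finset.sum_neg_distrib]
  linear_combination cyclic

lemma cov4_neg (T : ι → ι → ι → ι → A) (m p i k j : ι) :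
    X.cov4 (fun p i k j => -T p i k j) m p i k j = -X.cov4 T m p i k j := by
  simp only [cov4, map_neg, mul_neg, Finset.sum_neg_distrib]
  ring

lemma cov4_rm_swap_left (m p i k j : ι) : X.cov4 X.rm m p i k j = -X.cov4 X.rm m i p k j := by
  have swap : X.rm = fun p i k j => -X.rm i p k j := by
    funext p i k j; exact rm_swap_left p i k j
  conv_lhs => rw [swap, cov4_neg]
  simp only [cov4]
  ring

lemma cov4_rm_swap_right (m p i k j : ι) : X.cov4 X.rm m p i k j = -X.cov4 X.rm m p i j k := by
  have swap : X.rm = fun p i k j => -X.rm p i j k := by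
    funext p i k j; exact rm_swap_right p i k j
  conv_lhs => rw [swap, cov4_neg]
  simp only [cov4]
  ring

lemma cov2_ric (m i j : ι) : X.cov2 X.ric m i j = X.tr fun p k => X.cov4 X.rm m p i k j := by
  rw [← cov2_tr, ← funext₂ ric_eq_tr]

theorem contracted_bianchi (m : ι) : X.D m (X.tr X.ric) = 2 * X.div2 X.ric m := by
  have grad : X.D m (X.tr X.ric) = X.tr fun i j => X.tr fun p k => X.cov4 X.rm m p i k j := by
    rw [D_tr]; exact tr_congr fun i j => cov2_ric m i j
  have div_left : X.div2 X.ric m = X.tr fun i j => X.tr fun p k => -X.cov4 X.rm k p i j m := by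
    rw [tr_tr, div2, ← tr_symm]
    refine tr_congr fun p k => ?_
    rw [cov2_ric]
    exact tr_congr fun i j => by rw [cov4_rm_swap_left]
  have div_right : X.div2 X.ric m = X.tr fun i j => X.tr fun p k => -X.cov4 X.rm j p i m k := by
    rw [div2, ← tr_symm]
    refine tr_congr fun i j => ?_
    rw [cov2_ric]
    exact tr_congr fun p k => by rw [cov4_rm_swap_right]
  rw [two_mul]
  nth_rewrite 1 [div_left]
  simp only [grad, div_right, ← tr_add]
  exact tr_congr fun i j => tr_congr fun p k => by
    linear_combination second_bianchi (X := X) m p i k j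

/-! ### The Bochner formula -/

lemma cov1_eq_mulVec (a : ι → A) (m : ι) :
    X.cov1 a m = X.D m ∘ a - (X.Γ m).transpose.mulVec a :=
  rfl

lemma cov1_cov1_sub_cov1_cov1 (a : ι → A) (l i : ι) :
    X.cov1 (X.cov1 a i) l - X.cov1 (X.cov1 a l) i = -(X.curv l i).transpose.mulVec a := by
  have second (m p : ι) : X.cov1 (X.cov1 a p) m = X.D m ∘ X.D p ∘ a
      - ((X.Γ p).transpose.map (X.D m)).mulVec a - (X.Γ p).transpose.mulVec (X.D m ∘ a)
      - (X.Γ m).transpose.mulVec (X.D p ∘ a)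
      + ((X.Γ m).transpose * (X.Γ p).transpose).mulVec a := by
    have expand : X.D m ∘ X.cov1 a p =
        X.D m ∘ X.D p ∘ a - X.D m ∘ (X.Γ p).transpose.mulVec a :=
      funext fun k => map_sub (X.D m) _ _
    rw [cov1_eq_mulVec, expand, comp_mulVec, cov1_eq_mulVec, Matrix.mulVec_sub,
      Matrix.mulVec_mulVec]
    abel
  have commute : X.D l ∘ X.D i ∘ a = X.D i ∘ X.D l ∘ a := funext fun k => X.D_comm l i (a k)
  rw [second, second, curv, commute]
  simp only [Matrix.transpose_add, Matrix.transpose_sub, Matrix.transpose_mul,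
    ← Matrix.transpose_map, Matrix.add_mulVec, Matrix.sub_mulVec]
  abel

lemma cov2_cov1_comm (a : ι → A) (l i k : ι) : X.cov2 (X.cov1 a) l i k =
    X.cov2 (X.cov1 a) i l k - (X.curv l i).transpose.mulVec a k := by
  have ricci_identity := congrFun (cov1_cov1_sub_cov1_cov1 (X := X) a l i) k
  simp only [cov1, Pi.sub_apply, Pi.neg_apply] at ricci_identity
  simp only [cov2, cov1, Γ_symm (X := X) l i]
  linear_combination ricci_identity

lemma tr_cov2_hess (f : A) (i : ι) : (X.tr fun l k => X.cov2 (X.hess f) l k i) =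
    X.D i (X.lap f) + X.pair (fun p => X.ric p i) (X.grad f) := by
  have commute (l k : ι) : X.cov2 (X.hess f) l k i = X.cov2 (X.hess f) i l k
      + X.pair (fun p => X.rm k p l i) (X.grad f) := by
    have lower : (fun p => X.rm k p l i) = -X.g.mulVec fun s => X.curv l i s k := by
      ext p
      rw [rm_swap_left, rm, Matrix.mul_apply, Pi.neg_apply, Matrix.mulVec, dotProduct]
    rw [cov2_symm (hess_symm f), hess, cov2_cov1_comm, lower, ← Matrix.mulVec_neg, pair_g_mulVec,
      neg_dotProduct, sub_eq_add_neg]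
    rfl
  simp only [commute]
  rw [tr_add, lap, D_tr]
  simp only [pair]
  rw [tr_tr]
  congr 1
  refine tr_congr fun p q => ?_
  rw [tr_mul_right, ← tr_symm, ric_eq_tr]

lemma lap_pair_grad_self (f : A) : X.lap (X.pair (X.grad f) (X.grad f)) =
    2 * X.tr fun l k => X.cov1 (fun k => X.tr fun i j => X.hess f k i * X.grad f j) l k := by
  have grad_norm : X.grad (X.pair (X.grad f) (X.grad f)) =
      (2 : A) • fun k => X.tr fun i j => X.hess f k i * X.grad f j := by
    ext k
    rw [grad, D_pair, pair_comm (X.grad f), Pi.smul_apply, smul_eq_mul, two_mul]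
    rfl
  rw [lap_eq_div1, grad_norm, div1_smul, grad_two, pair_zero_left, add_zero]
  rfl

theorem bochner (f : A) : X.lap (X.pair (X.grad f) (X.grad f)) =
    2 * X.pair2 (X.hess f) (X.hess f) + 2 * X.pair (X.grad f) (X.grad (X.lap f))
      + 2 * X.pair2 X.ric fun i j => X.grad f i * X.grad f j := by
  have expand (l k : ι) : X.cov1 (fun k => X.tr fun i j => X.hess f k i * X.grad f j) l k =
      (X.tr fun i j => X.cov2 (X.hess f) l k i * X.grad f j)
        + X.tr fun i j => X.hess f k i * X.hess f l j := by
    rw [cov1_tr, ← tr_add]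
    exact tr_congr fun i j => cov3_mul (X.hess f) (X.grad f) l k i j
  have hess_norm : (X.tr fun l k => X.tr fun i j => X.hess f k i * X.hess f l j) =
      X.pair2 (X.hess f) (X.hess f) := by
    rw [← tr_symm]
    rfl
  have commute : (X.tr fun l k => X.tr fun i j => X.cov2 (X.hess f) l k i * X.grad f j) =
      X.pair (X.grad f) (X.grad (X.lap f))
        + X.pair2 X.ric fun i j => X.grad f i * X.grad f j := by
    rw [tr_tr, pair_comm, pair, pair2,
      tr_tr fun i k j l => X.ric i j * (X.grad f k * X.grad f l), ← tr_add]
    refine tr_congr fun i j => ?_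
    rw [tr_mul_right, tr_cov2_hess, add_mul, pair, ← tr_mul_right]
    congr 1
    exact tr_congr fun p q => mul_assoc _ _ _
  rw [lap_pair_grad_self]
  simp only [expand]
  rw [tr_add, hess_norm, commute]
  ring

end CoordMetric

namespace CoordMetric

/-! ### Variation of the metric -/

variable {ι A : Type*} [Fintype ι] [DecidableEq ι] [CommRing A] [Algebra ℝ A]
  (X : CoordMetric ι A) (d : Derivation ℝ A A)

/-- The variation of the metric along the derivation `d`. -/
def dg (i j : ι) : A := d (X.g i j)

/-- The variation of the Christoffel symbols along the derivation `d`, with the upper index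
lowered. -/
def dΓ (p i j : ι) : A := (X.g * (X.Γ i).map d) p j

variable {X}

lemma dΓ_symm (p i j : ι) : X.dΓ d p i j = X.dΓ d p j i := by
  simp only [dΓ, Matrix.mul_apply, Matrix.map_apply, X.Γ_symm i j]

lemma pair2_eq_trace (S T : ι → ι → A) : X.pair2 S T =
    (X.g⁻¹ * Matrix.of S * (X.g⁻¹ * (Matrix.of T).transpose)).trace := by
  have inner (i k : ι) : (X.tr fun j l => S i j * T k l) =
      (Matrix.of S * (X.g⁻¹ * (Matrix.of T).transpose)) i k := by
    simp only [tr, Matrix.mul_apply, Matrix.transpose_apply, Matrix.of_apply, Finset.mul_sum,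
      mul_left_comm (S i _)]
  simp only [pair2, inner]
  rw [tr_eq_trace, Matrix.mul_assoc]
  rfl

lemma d_tr (T : ι → ι → A) : d (X.tr T) = (X.tr fun i j => d (T i j)) - X.pair2 (X.dg d) T := by
  rw [← tr_symm, tr_eq_trace, map_matrix_trace, map_matrix_mul, map_matrix_inv d X.isUnit_det,
    pair2_eq_trace, ← tr_symm, tr_eq_trace, Matrix.neg_mul, Matrix.trace_add, Matrix.trace_neg,
    Matrix.mul_assoc, neg_add_eq_sub]
  rfl

lemma d_pair (a b : ι → A) : d (X.pair a b) =
    X.pair (fun i => d (a i)) b + X.pair a (fun i => d (b i))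
      - X.pair2 (X.dg d) (fun i j => a i * b j) := by
  rw [pair, d_tr, pair, pair, ← tr_add]
  congr 1
  exact tr_congr fun i j => by rw [Derivation.leibniz, smul_eq_mul, smul_eq_mul]; ring

variable {d}

lemma cov2_dg (hd : ∀ i a, d (X.D i a) = X.D i (d a)) (m i j : ι) :
    X.cov2 (X.dg d) m i j = X.dΓ d j m i + X.dΓ d i m j := by
  have variation : (X.g.map (X.D m)).map d = (X.g.map d).map (X.D m) :=
    map_matrix_comm (hd m) X.g
  rw [map_D_g, Matrix.map_add _ (map_add _), map_matrix_mul, map_matrix_mul,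
    Matrix.transpose_map] at variation
  have lowered : ((X.Γ m).map d).transpose * X.g = (X.g * (X.Γ m).map d).transpose := by
    rw [Matrix.transpose_mul, X.g_symm]
  have entry := congrFun (congrFun (X.of_cov2 (X.dg d) m) i) j
  rw [show Matrix.of (X.dg d) = X.g.map d from rfl, ← variation, lowered] at entry
  simp only [Matrix.of_apply, Matrix.sub_apply, Matrix.add_apply, Matrix.transpose_apply] at entry
  rw [entry, dΓ, dΓ]
  ring

lemma two_mul_dΓ (hd : ∀ i a, d (X.D i a) = X.D i (d a)) (p i j : ι) : 2 * X.dΓ d p i j =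
    X.cov2 (X.dg d) i j p + X.cov2 (X.dg d) j i p - X.cov2 (X.dg d) p i j := by
  rw [cov2_dg hd, cov2_dg hd, cov2_dg hd, dΓ_symm d j p i, dΓ_symm d i p j, dΓ_symm d p j i]
  ring

lemma two_mul_tr_dΓ (hd : ∀ i a, d (X.D i a) = X.D i (d a)) :
    (2 : A) • (fun p => X.tr (X.dΓ d p)) = (2 : A) • X.div2 (X.dg d) - X.grad (X.tr (X.dg d)) := by
  ext p
  simp only [Pi.smul_apply, Pi.sub_apply, smul_eq_mul]
  rw [grad, D_tr, ← tr_mul_left, two_mul, div2]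
  nth_rewrite 2 [← tr_symm]
  rw [← tr_add, ← tr_sub]
  exact tr_congr fun i j => by rw [two_mul_dΓ hd]; ring

lemma two_mul_tr_dΓ_left (hd : ∀ i a, d (X.D i a) = X.D i (d a)) :
    (2 : A) • (fun i => X.tr fun p k => X.dΓ d p k i) = X.grad (X.tr (X.dg d)) := by
  ext i
  rw [Pi.smul_apply, smul_eq_mul, grad, D_tr, two_mul]
  nth_rewrite 2 [← tr_symm]
  rw [← tr_add]
  exact tr_congr fun p k => by rw [cov2_dg hd, dΓ_symm d p k, dΓ_symm d k p]; ring

lemma d_hess (hd : ∀ i a, d (X.D i a) = X.D i (d a)) (f : A) (i j : ι) :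
    d (X.hess f i j) = X.hess (d f) i j - X.pair (fun p => X.dΓ d p i j) (X.grad f) := by
  have raised : X.pair (fun p => X.dΓ d p i j) (X.grad f) = ∑ k, d (X.Γ i k j) * X.D k f :=
    pair_g_mulVec (fun k => d (X.Γ i k j)) (X.grad f)
  rw [raised]
  simp only [hess, cov1, grad, map_sub, map_sum, Derivation.leibniz, smul_eq_mul, hd,
    Finset.sum_add_distrib, mul_comm (X.D _ f)]
  ring

theorem d_lap (hd : ∀ i a, d (X.D i a) = X.D i (d a)) (f : A) : d (X.lap f) =
    X.lap (d f) - X.pair2 (X.dg d) (X.hess f) - X.pair (fun p => X.tr (X.dΓ d p)) (X.grad f) := by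
  rw [lap, d_tr]
  simp only [d_hess hd]
  rw [tr_sub]
  simp only [pair]
  rw [tr_tr]
  simp only [tr_mul_right]
  rw [lap]
  ring

lemma cov3_dΓ (m p i j : ι) : X.cov3 (X.dΓ d) m p i j =
    (X.g * X.covEnd ((X.Γ i).map d) m) p j - ∑ s, X.Γ m s i * X.dΓ d p s j := by
  rw [g_mul_covEnd, Matrix.sub_apply, Matrix.sub_apply, Matrix.mul_apply,
    Matrix.mul_apply (M := X.g * (X.Γ i).map d)]
  simp only [cov3, dΓ, Matrix.map_apply, Matrix.transpose_apply, mul_comm (X.Γ m _ j)]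
  ring

lemma map_curv (hd : ∀ i a, d (X.D i a) = X.D i (d a)) (k j : ι) : (X.curv k j).map d =
    X.covEnd ((X.Γ j).map d) k - X.covEnd ((X.Γ k).map d) j := by
  simp only [curv, covEnd, Matrix.map_add _ (map_add _), Matrix.map_sub _ (map_sub _),
    map_matrix_mul, map_matrix_comm (hd _)]
  noncomm_ring

lemma d_ric (hd : ∀ i a, d (X.D i a) = X.D i (d a)) (i j : ι) : d (X.ric i j) =
    X.tr fun p k => X.cov3 (X.dΓ d) k p j i - X.cov3 (X.dΓ d) j p k i := by
  have lowered (p k : ι) : X.cov3 (X.dΓ d) k p j i - X.cov3 (X.dΓ d) j p k i =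
      (X.g * (X.curv k j).map d) p i := by
    rw [map_curv hd, Matrix.mul_sub, Matrix.sub_apply, cov3_dΓ, cov3_dΓ]
    simp only [X.Γ_symm k j]
    ring
  have raised (k : ι) : (X.curv k j).map d k i =
      ∑ p, X.g⁻¹ k p * (X.g * (X.curv k j).map d) p i := by
    rw [← Matrix.mul_apply, ← Matrix.mul_assoc, inv_mul_g, Matrix.one_mul]
  rw [← tr_symm]
  simp only [lowered]
  rw [ric, map_sum]
  exact Finset.sum_congr rfl fun k _ => raised k

lemma isUnit_two : IsUnit (2 : A) := by
  simpa only [map_ofNat] using (IsUnit.mk0 (2 : ℝ) two_ne_zero).map (algebraMap ℝ A)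

theorem d_scal (hd : ∀ i a, d (X.D i a) = X.D i (d a)) : d (X.tr X.ric) =
    X.div1 (X.div2 (X.dg d)) - X.lap (X.tr (X.dg d)) - X.pair2 (X.dg d) X.ric := by
  have div_terms : (X.tr fun i j => d (X.ric i j)) = X.div1 (fun p => X.tr (X.dΓ d p))
      - X.div1 fun i => X.tr fun p k => X.dΓ d p k i := by
    simp only [d_ric hd, tr_sub]
    congr 1
    · rw [tr_tr, div1, ← tr_symm]
      refine tr_congr fun k p => ?_
      rw [cov1_tr, ← tr_symm]
    · rw [div1, ← tr_symm]
      refine tr_congr fun j i => ?_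
      rw [cov1_tr]
      exact tr_congr fun p k => by simp only [cov3]; ring
  have double (a : ι → A) : 2 * X.div1 a = X.div1 ((2 : A) • a) := by
    rw [div1_smul, grad_two, pair_zero_left, add_zero]
  refine isUnit_two.mul_left_cancel ?_
  rw [d_tr, div_terms, mul_sub, mul_sub, double, double, two_mul_tr_dΓ hd, two_mul_tr_dΓ_left hd,
    div1_sub, ← double, ← lap_eq_div1]
  ring

end CoordMetric

/-! ### Maps into a Riemannian manifold -/

/-- A map into a Riemannian manifold in coordinates, in algebraic form: `φ` are the components of
the map, and `H` and `ΓN a b c` those of the target metric and of its Christoffel symbols `Γᵃ_bc`,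
both composed with the map. -/
structure CoordMap (κ A : Type*) where
  φ : κ → A
  H : Matrix κ κ A
  ΓN : κ → κ → κ → A
  H_symm : H.IsSymm
  ΓN_symm : ∀ a b c, ΓN a b c = ΓN a c b

namespace CoordMap

variable {κ A : Type*} [Fintype κ] [CommRing A] (Y : CoordMap κ A)

/-- The inner product of two vector fields along the map. -/
def ip (V W : κ → A) : A := V ⬝ᵥ Y.H.mulVec W

variable {Y}

lemma ip_comm (V W : κ → A) : Y.ip V W = Y.ip W V := by
  rw [ip, ip, dotProduct_comm, ← Matrix.vecMul_transpose, Y.H_symm, ← Matrix.dotProduct_mulVec]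

lemma ip_add_left (V V' W : κ → A) : Y.ip (V + V') W = Y.ip V W + Y.ip V' W :=
  add_dotProduct V V' _

lemma ip_sub_self (V W : κ → A) :
    Y.ip (V - W) (V - W) = Y.ip V V - 2 * Y.ip V W + Y.ip W W := by
  have sub_left (V V' W : κ → A) : Y.ip (V - V') W = Y.ip V W - Y.ip V' W := sub_dotProduct V V' _
  rw [sub_left, ip_comm V, ip_comm W, sub_left, sub_left, ip_comm W V]
  ring

variable [Algebra ℝ A]

variable (Y) in
/-- The derivative of the map along the derivation `d`, a vector field along the map. -/
def deriv (d : Derivation ℝ A A) (a : κ) : A := d (Y.φ a)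

variable (Y) in
/-- The matrix of the pulled back Levi-Civita connection in the direction `d`. -/
def conn (d : Derivation ℝ A A) : Matrix κ κ A :=
  Matrix.of fun a c => ∑ b, Y.ΓN a b c * Y.deriv d b

variable (Y) in
/-- The target metric is parallel along the derivation `d`. -/
def IsCompat (d : Derivation ℝ A A) : Prop :=
  Y.H.map d = (Y.conn d).transpose * Y.H + Y.H * Y.conn d

variable (Y) in
/-- The pulled back covariant derivative of a vector field along the map. -/
def nab (d : Derivation ℝ A A) (V : κ → A) : κ → A := d ∘ V + (Y.conn d).mulVec V

lemma d_ip {d : Derivation ℝ A A} (hd : Y.IsCompat d) (V W : κ → A) :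
    d (Y.ip V W) = Y.ip (Y.nab d V) W + Y.ip V (Y.nab d W) := by
  have parallel : Y.H.map d = (Y.conn d).transpose * Y.H + Y.H * Y.conn d := hd
  simp only [ip, nab, map_dotProduct, comp_mulVec, parallel, Matrix.add_mulVec, Matrix.mulVec_add,
    add_dotProduct, dotProduct_add, ← Matrix.mulVec_mulVec]
  rw [Matrix.dotProduct_mulVec V (Y.conn d).transpose, Matrix.vecMul_transpose]
  ring

lemma conn_mulVec_deriv (d d' : Derivation ℝ A A) :
    (Y.conn d).mulVec (Y.deriv d') = (Y.conn d').mulVec (Y.deriv d) := by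
  ext a
  simp only [Matrix.mulVec, dotProduct, conn, Matrix.of_apply, Finset.sum_mul]
  rw [Finset.sum_comm]
  refine Finset.sum_congr rfl fun b _ => Finset.sum_congr rfl fun c _ => ?_
  rw [Y.ΓN_symm]
  ring

lemma nab_deriv_comm {d d' : Derivation ℝ A A} (h : ∀ a, d (d' a) = d' (d a)) :
    Y.nab d (Y.deriv d') = Y.nab d' (Y.deriv d) := by
  rw [nab, nab, conn_mulVec_deriv]
  congr 1
  exact funext fun a => h (Y.φ a)

end CoordMap

namespace CoordMetric

variable {ι κ A : Type*} [Fintype ι] [DecidableEq ι] [Fintype κ] [CommRing A] [Algebra ℝ A]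
  (X : CoordMetric ι A) (Y : CoordMap κ A)

/-- The pullback of the target metric, `⟨∇ᵢφ, ∇ⱼφ⟩`. -/
def pb (i j : ι) : A := Y.ip (Y.deriv (X.D i)) (Y.deriv (X.D j))

/-- The second fundamental form `∇ᵢ∇ⱼφ` of the map. -/
def sff (i j : ι) : κ → A :=
  (fun a => X.hess (Y.φ a) i j) + (Y.conn (X.D i)).mulVec (Y.deriv (X.D j))

/-- The tension field of the map. -/
def tens (a : κ) : A := X.tr fun i j => X.sff Y i j a

/-- The one-form `⟨V, ∇φ⟩`. -/
def along (V : κ → A) (i : ι) : A := Y.ip V (Y.deriv (X.D i))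

/-- The derivative `⟨∇φ, b⟩` of the map in the direction dual to the one-form `b`. -/
def pushed (b : ι → A) (a : κ) : A := X.pair (X.grad (Y.φ a)) b

variable {X Y}

lemma tens_apply (a : κ) : X.tens Y a = X.lap (Y.φ a) +
    ∑ b, ∑ c, Y.ΓN a b c * X.pair (X.grad (Y.φ b)) (X.grad (Y.φ c)) := by
  simp only [tens, sff, Pi.add_apply, tr_add, lap, pair, ← tr_mul_left, ← tr_sum]
  congr 1
  refine tr_congr fun i j => ?_
  simp only [Matrix.mulVec, dotProduct, CoordMap.conn, Matrix.of_apply, Finset.sum_mul]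
  rw [Finset.sum_comm]
  simp only [mul_assoc]
  rfl

lemma sff_symm (i j : ι) : X.sff Y i j = X.sff Y j i := by
  simp only [sff, hess_symm _ i j, Y.conn_mulVec_deriv (X.D i)]

lemma nab_deriv (m i : ι) : Y.nab (X.D m) (Y.deriv (X.D i)) =
    X.sff Y m i + ∑ k, X.Γ m k i • Y.deriv (X.D k) := by
  ext a
  simp only [CoordMap.nab, sff, hess, cov1, Pi.add_apply, Finset.sum_apply, Pi.smul_apply,
    smul_eq_mul, Function.comp_apply, CoordMap.deriv, grad]
  ring

lemma ip_nab_deriv (V : κ → A) (m i : ι) : Y.ip V (Y.nab (X.D m) (Y.deriv (X.D i))) =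
    Y.ip V (X.sff Y m i) + ∑ k, X.Γ m k i * X.along Y V k := by
  simp only [nab_deriv, along, Y.ip_comm V, Y.ip_add_left]
  simp only [CoordMap.ip, sum_dotProduct, smul_dotProduct, smul_eq_mul]

lemma tr_ip (V : ι → ι → κ → A) (W : κ → A) :
    (X.tr fun i j => Y.ip (V i j) W) = Y.ip (fun a => X.tr fun i j => V i j a) W := by
  simp only [CoordMap.ip, dotProduct, tr_sum, tr_mul_right]

lemma cov1_along (hY : ∀ i, Y.IsCompat (X.D i)) (V : κ → A) (m i : ι) :
    X.cov1 (X.along Y V) m i = X.along Y (Y.nab (X.D m) V) i + Y.ip V (X.sff Y m i) := by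
  rw [cov1, along, Y.d_ip (hY m), ip_nab_deriv, along]
  ring

lemma cov2_pb (hY : ∀ i, Y.IsCompat (X.D i)) (m i j : ι) : X.cov2 (X.pb Y) m i j =
    X.along Y (X.sff Y m i) j + X.along Y (X.sff Y m j) i := by
  rw [cov2, pb, Y.d_ip (hY m), Y.ip_comm, ip_nab_deriv, ip_nab_deriv]
  simp only [along, pb, Y.ip_comm (Y.deriv (X.D i)), Y.ip_comm (Y.deriv (X.D j))]
  ring

lemma tr_along_sff (j : ι) :
    (X.tr fun m i => X.along Y (X.sff Y m i) j) = X.along Y (X.tens Y) j :=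
  tr_ip (X.sff Y) _

lemma two_mul_div2_pb (hY : ∀ i, Y.IsCompat (X.D i)) (j : ι) :
    2 * X.div2 (X.pb Y) j = 2 * X.along Y (X.tens Y) j + X.D j (X.tr (X.pb Y)) := by
  have grad_energy :
      X.D j (X.tr (X.pb Y)) = 2 * X.tr fun m i => X.along Y (X.sff Y m j) i := by
    rw [D_tr, two_mul]
    nth_rewrite 2 [← tr_symm]
    rw [← tr_add]
    exact tr_congr fun m i => by rw [cov2_pb hY, sff_symm j m, sff_symm j i, add_comm]
  simp only [div2, cov2_pb hY, tr_add]
  rw [grad_energy, tr_along_sff]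
  ring

lemma div1_along (hY : ∀ i, Y.IsCompat (X.D i)) (V : κ → A) : X.div1 (X.along Y V) =
    (X.tr fun i j => X.along Y (Y.nab (X.D i) V) j) + Y.ip V (X.tens Y) := by
  simp only [div1, funext₂ (cov1_along hY V), tr_add, Y.ip_comm V, tr_ip]
  rfl

lemma d_pb {d : Derivation ℝ A A} (hYd : Y.IsCompat d) (hd : ∀ i a, d (X.D i a) = X.D i (d a))
    (i j : ι) : d (X.pb Y i j) = X.along Y (Y.nab (X.D i) (Y.deriv d)) j
      + X.along Y (Y.nab (X.D j) (Y.deriv d)) i := by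
  rw [pb, Y.d_ip hYd, Y.nab_deriv_comm (hd i), Y.nab_deriv_comm (hd j),
    Y.ip_comm (Y.deriv (X.D i)), along, along]

theorem d_energy (hY : ∀ i, Y.IsCompat (X.D i)) {d : Derivation ℝ A A} (hYd : Y.IsCompat d)
    (hd : ∀ i a, d (X.D i a) = X.D i (d a)) : d (X.tr (X.pb Y)) =
      2 * X.div1 (X.along Y (Y.deriv d)) - 2 * Y.ip (Y.deriv d) (X.tens Y)
        - X.pair2 (X.dg d) (X.pb Y) := by
  rw [d_tr, div1_along hY]
  simp only [d_pb hYd hd, tr_add]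
  rw [tr_symm fun i j => X.along Y (Y.nab (X.D i) (Y.deriv d)) j]
  ring

lemma pair_along (V : κ → A) (b : ι → A) : X.pair (X.along Y V) b = Y.ip V (X.pushed Y b) := by
  have contract : (fun a => X.tr fun i j => (b j • Y.deriv (X.D i)) a) = X.pushed Y b :=
    funext fun a => tr_congr fun i j => mul_comm _ _
  rw [Y.ip_comm, ← contract, ← tr_ip]
  refine tr_congr fun i j => ?_
  rw [along, Y.ip_comm, CoordMap.ip, CoordMap.ip, smul_dotProduct, smul_eq_mul, mul_comm]

lemma pair2_pb_mul (b : ι → A) :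
    X.pair2 (X.pb Y) (fun i j => b i * b j) = Y.ip (X.pushed Y b) (X.pushed Y b) := by
  rw [← pair_along, pair2, pair]
  refine tr_congr fun i k => ?_
  rw [along, Y.ip_comm, ← pair_along, pair, ← tr_mul_right]
  exact tr_congr fun j l => by rw [along, pb]; ring

end CoordMetric

/-! ### The flow equations and the Harnack quantity -/

namespace CoordMetric

variable {ι κ A B : Type*} [Fintype ι] [DecidableEq ι] [Fintype κ] [CommRing A] [Algebra ℝ A]
  [CommRing B] {X : CoordMetric ι A} {Y : CoordMap κ A}

section Congr

variable {ρ : A →+* B}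

lemma map_tr_congr {S T : ι → ι → A} (h : ∀ i j, ρ (S i j) = ρ (T i j)) :
    ρ (X.tr S) = ρ (X.tr T) := by
  simp only [tr, map_sum, map_mul, h]

lemma map_pair_congr {a a' : ι → A} (b : ι → A) (h : ∀ i, ρ (a i) = ρ (a' i)) :
    ρ (X.pair a b) = ρ (X.pair a' b) :=
  map_tr_congr fun i j => by simp only [map_mul, h]

lemma map_pair2_congr {S S' : ι → ι → A} (T : ι → ι → A) (h : ∀ i j, ρ (S i j) = ρ (S' i j)) :
    ρ (X.pair2 S T) = ρ (X.pair2 S' T) :=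
  map_tr_congr fun i k => map_tr_congr fun j l => by simp only [map_mul, h]

variable (hρ : ∀ i a b, ρ a = ρ b → ρ (X.D i a) = ρ (X.D i b))
include hρ

lemma map_div1_congr {a b : ι → A} (h : ∀ i, ρ (a i) = ρ (b i)) : ρ (X.div1 a) = ρ (X.div1 b) :=
  map_tr_congr fun m i => by simp only [cov1, map_sub, map_sum, map_mul, h, hρ m _ _ (h i)]

lemma map_div2_congr {S T : ι → ι → A} (h : ∀ i j, ρ (S i j) = ρ (T i j)) (j : ι) :
    ρ (X.div2 S j) = ρ (X.div2 T j) :=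
  map_tr_congr fun m i => by simp only [cov2, map_sub, map_sum, map_mul, h, hρ m _ _ (h i j)]

lemma map_lap_congr {a b : A} (h : ρ a = ρ b) : ρ (X.lap a) = ρ (X.lap b) :=
  map_div1_congr hρ fun i => hρ i _ _ h

end Congr

lemma grad_neg_two : X.grad (-2) = 0 := by rw [grad_neg, grad_two, neg_zero]

lemma lap_eq_of_grad_eq {l v : A} (hv : X.grad v = -(v • X.grad l)) :
    X.lap v = v * (X.pair (X.grad l) (X.grad l) - X.lap l) := by
  rw [lap_eq_div1, hv, div1_neg, div1_smul, hv, pair_neg_left, pair_smul_left, ← lap_eq_div1]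
  ring

lemma lap_smul_of_grad_eq_zero {c : A} (hc : X.grad c = 0) (a : A) :
    X.lap (c * a) = c * X.lap a := by
  rw [lap_mul, lap_of_grad_eq_zero hc, hc, pair_zero_left]
  ring

lemma div2_sub (S T : ι → ι → A) : X.div2 (S - T) = X.div2 S - X.div2 T := by
  ext j
  simp only [div2, Pi.sub_apply, ← tr_sub]
  refine tr_congr fun m i => ?_
  simp only [cov2, Pi.sub_apply, map_sub, mul_sub, Finset.sum_sub_distrib]
  ring

lemma div2_smul {c : A} (hc : X.grad c = 0) (T : ι → ι → A) : X.div2 (c • T) = c • X.div2 T := by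
  ext j
  have const (m : ι) : X.D m c = 0 := congrFun hc m
  simp only [div2, Pi.smul_apply, smul_eq_mul, ← tr_mul_left]
  refine tr_congr fun m i => ?_
  simp only [cov2, Pi.smul_apply, Derivation.leibniz, smul_eq_mul, const, mul_sub, Finset.mul_sum,
    mul_left_comm _ c]
  ring

lemma pair2_add_self (S T : ι → ι → A) :
    X.pair2 (S + T) (S + T) = X.pair2 S S + 2 * X.pair2 S T + X.pair2 T T := by
  rw [pair2_add_left, pair2_comm S, pair2_comm T, pair2_add_left, pair2_add_left, pair2_comm T S]
  ring

lemma pair2_sub_smul_g_self (T : ι → ι → A) (c : A) :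
    X.pair2 (T - c • fun i j => X.g i j) (T - c • fun i j => X.g i j) =
      X.pair2 T T - 2 * c * X.tr T + c ^ 2 * Fintype.card ι := by
  have trace : X.tr (T - c • fun i j => X.g i j) = X.tr T - c * Fintype.card ι := by
    rw [← tr_g, ← tr_mul_left, ← tr_sub]
    rfl
  rw [pair2_sub_left, pair2_comm T, pair2_sub_left, pair2_smul_left, pair2_smul_left, pair2_g,
    pair2_g, trace]
  ring

variable (X Y) in
/-- The tensor `S = Ric - β ∇φ ⊗ ∇φ`. -/
def tensS (β : A) : ι → ι → A := X.ric - β • X.pb Y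

lemma tr_tensS (β : A) : X.tr (X.tensS Y β) = X.tr X.ric - β * X.tr (X.pb Y) := by
  rw [← tr_mul_left, ← tr_sub]
  rfl

lemma pair2_tensS (β : A) (T : ι → ι → A) :
    X.pair2 (X.tensS Y β) T = X.pair2 X.ric T - β * X.pair2 (X.pb Y) T := by
  rw [tensS, pair2_sub_left, pair2_smul_left]

lemma two_mul_div2_tensS {β : A} (hY : ∀ i, Y.IsCompat (X.D i)) (hβ : X.grad β = 0) :
    2 • X.div2 (X.tensS Y β) = X.grad (X.tr (X.tensS Y β)) - (2 * β) • X.along Y (X.tens Y) := by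
  ext j
  rw [tensS, div2_sub, div2_smul hβ, ← tensS, tr_tensS, grad_sub, grad_mul, hβ]
  simp only [Pi.smul_apply, Pi.sub_apply, Pi.add_apply, Pi.zero_apply, smul_eq_mul, nsmul_eq_mul,
    Nat.cast_ofNat, grad, contracted_bianchi]
  linear_combination -β * two_mul_div2_pb hY j

/-- The equations of the harmonic Ricci flow for the variation `d`, in algebraic form. The ring
homomorphism `ρ` stands for the restriction to a time slice, and the flow equations are only
assumed there; `congr` says that `D i` acts on the functions on that slice. -/
structure IsFlow (X : CoordMetric ι A) (Y : CoordMap κ A) (β : A) (d : Derivation ℝ A A)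
    (ρ : A →+* B) : Prop where
  congr : ∀ i a b, ρ a = ρ b → ρ (X.D i a) = ρ (X.D i b)
  compat : ∀ i, Y.IsCompat (X.D i)
  compat_d : Y.IsCompat d
  comm : ∀ i a, d (X.D i a) = X.D i (d a)
  grad_coupling : X.grad β = 0
  metric_eq : ∀ i j, ρ (d (X.g i j)) = ρ (-2 * X.tensS Y β i j)
  map_eq : ∀ a, ρ (d (Y.φ a)) = ρ (X.tens Y a)

variable (X) in
/-- The function `v = (4πσ)^(-n/2) e^(-l)`, characterised by its derivatives, for `σ = T - t`.
The element `c` is the inverse of `2σ`. -/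
structure IsKernel (d : Derivation ℝ A A) (σ c l v : A) : Prop where
  grad_time : X.grad σ = 0
  d_time : d σ = -1
  two_mul_time_mul : 2 * σ * c = 1
  isUnit : IsUnit v
  grad_eq : X.grad v = -(v • X.grad l)
  d_eq : d v = v * (Fintype.card ι * c - d l)

variable (X Y) in
/-- The function `2Δl - |∇l|² + tr S`. -/
def harnackDensity (β l : A) : A :=
  2 * X.lap l - X.pair (X.grad l) (X.grad l) + X.tr (X.tensS Y β)

variable (X Y) in
/-- The function `w = (σ (2Δl - |∇l|² + tr S) + l - n) v`. -/
def harnack (β σ l v : A) : A := (σ * X.harnackDensity Y β l + l - Fintype.card ι) * v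

variable (X Y) in
/-- The adjoint heat operator `-d - Δ + tr S`. -/
def adjointHeat (β : A) (d : Derivation ℝ A A) (a : A) : A :=
  -d a - X.lap a + X.tr (X.tensS Y β) * a

variable {β : A} {d : Derivation ℝ A A} {ρ : A →+* B}

lemma adjointHeat_mul {l v : A} (hv : X.grad v = -(v • X.grad l)) (P : A) :
    X.adjointHeat Y β d (P * v) = P * X.adjointHeat Y β d v
      - (d P + X.lap P - 2 * X.pair (X.grad P) (X.grad l)) * v := by
  rw [adjointHeat, adjointHeat, lap_mul, hv, pair_comm, pair_neg_left, pair_smul_left, pair_comm,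
    Derivation.leibniz, smul_eq_mul, smul_eq_mul]
  ring

namespace IsKernel

variable {σ c l v : A} (hv : X.IsKernel d σ c l v)
include hv

lemma grad_const : X.grad c = 0 := by
  have vanishing : (2 * σ) • X.grad c = 0 := by
    have leibniz := grad_mul (X := X) (2 * σ) c
    have const : X.grad (2 * σ) = 0 := by
      rw [grad_mul, grad_two, hv.grad_time, smul_zero, smul_zero, add_zero]
    rw [hv.two_mul_time_mul, const, smul_zero, add_zero] at leibniz
    exact leibniz.symm.trans (funext fun i => (X.D i).map_one_eq_zero)
  calc X.grad c = c • (2 * σ) • X.grad c := by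
        rw [smul_smul, mul_comm c, hv.two_mul_time_mul, one_smul]
    _ = 0 := by rw [vanishing, smul_zero]

lemma map_d_potential (heat : ρ (X.adjointHeat Y β d v) = 0) :
    ρ (d l) = ρ (X.lap l - X.harnackDensity Y β l + Fintype.card ι * c) := by
  have factored : X.adjointHeat Y β d v =
      v * (d l - (X.lap l - X.harnackDensity Y β l + Fintype.card ι * c)) := by
    rw [adjointHeat, hv.d_eq, lap_eq_of_grad_eq hv.grad_eq, harnackDensity]
    ring
  rw [factored, map_mul, (hv.isUnit.map ρ).mul_right_eq_zero, map_sub] at heat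
  exact sub_eq_zero.mp heat

end IsKernel

namespace IsFlow

variable (hF : IsFlow X Y β d ρ)
include hF

lemma map_dg (i j : ι) : ρ (X.dg d i j) = ρ (((-2 : A) • X.tensS Y β) i j) := hF.metric_eq i j

lemma map_tr_dg : ρ (X.tr (X.dg d)) = ρ (-2 * X.tr (X.tensS Y β)) := by
  rw [← tr_mul_left]
  exact map_tr_congr hF.map_dg

lemma map_pair2_dg (T : ι → ι → A) :
    ρ (X.pair2 (X.dg d) T) = ρ (-2 * X.pair2 (X.tensS Y β) T) := by
  rw [← pair2_smul_left]
  exact map_pair2_congr T hF.map_dg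

lemma map_div2_dg (j : ι) : ρ (X.div2 (X.dg d) j) =
    ρ (((2 * β) • X.along Y (X.tens Y) - X.grad (X.tr (X.tensS Y β))) j) := by
  rw [map_div2_congr hF.congr hF.map_dg, div2_smul grad_neg_two]
  congr 1
  have divergence := congrFun (two_mul_div2_tensS hF.compat hF.grad_coupling) j
  simp only [Pi.smul_apply, Pi.sub_apply, smul_eq_mul, nsmul_eq_mul, Nat.cast_ofNat]
    at divergence ⊢
  linear_combination -divergence

lemma map_ip_deriv (V : κ → A) : ρ (Y.ip (Y.deriv d) V) = ρ (Y.ip (X.tens Y) V) := by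
  simp only [CoordMap.ip, CoordMap.deriv, dotProduct, map_sum, map_mul, hF.map_eq]

lemma map_d_scal : ρ (d (X.tr X.ric)) = ρ (X.lap (X.tr (X.tensS Y β))
    + 2 * β * X.div1 (X.along Y (X.tens Y)) + 2 * X.pair2 (X.tensS Y β) X.ric) := by
  have grad_two_mul : X.grad (2 * β) = 0 := by
    rw [grad_mul, grad_two, hF.grad_coupling, smul_zero, smul_zero, add_zero]
  rw [d_scal hF.comm, map_sub, map_sub, map_div1_congr hF.congr hF.map_div2_dg,
    map_lap_congr hF.congr hF.map_tr_dg, hF.map_pair2_dg, div1_sub, div1_smul, grad_two_mul,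
    pair_zero_left, ← lap_eq_div1, lap_smul_of_grad_eq_zero grad_neg_two, ← map_sub, ← map_sub]
  congr 1
  ring

lemma map_d_energy : ρ (d (X.tr (X.pb Y))) = ρ (2 * X.div1 (X.along Y (X.tens Y))
    - 2 * Y.ip (X.tens Y) (X.tens Y) + 2 * X.pair2 (X.tensS Y β) (X.pb Y)) := by
  have div_along : ρ (X.div1 (X.along Y (Y.deriv d))) = ρ (X.div1 (X.along Y (X.tens Y))) :=
    map_div1_congr hF.congr fun i => hF.map_ip_deriv _
  have metric := hF.map_pair2_dg (X.pb Y)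
  rw [d_energy hF.compat hF.compat_d hF.comm]
  simp only [map_sub, map_mul, map_add, map_neg, map_ofNat] at metric ⊢
  rw [div_along, metric, hF.map_ip_deriv]
  ring

theorem map_d_tr_tensS : ρ (d (X.tr (X.tensS Y β))) =
    ρ (X.lap (X.tr (X.tensS Y β)) + 2 * X.pair2 (X.tensS Y β) (X.tensS Y β)
      + 2 * β * Y.ip (X.tens Y) (X.tens Y) - d β * X.tr (X.pb Y)) := by
  have scal := hF.map_d_scal
  have energy := hF.map_d_energy
  rw [pair2_tensS β (X.tensS Y β), pair2_comm X.ric, pair2_comm (X.pb Y)]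
  nth_rewrite 1 [tr_tensS]
  simp only [map_sub, map_mul, map_add, map_ofNat, Derivation.leibniz, smul_eq_mul]
    at scal energy ⊢
  linear_combination scal - ρ β * energy

theorem map_d_lap (l : A) : ρ (d (X.lap l)) = ρ (X.lap (d l)
    + 2 * X.pair2 (X.tensS Y β) (X.hess l) - 2 * β * Y.ip (X.tens Y) (X.pushed Y (X.grad l))) := by
  have trace_dΓ (p : ι) :
      ρ (X.tr (X.dΓ d p)) = ρ (((2 * β) • X.along Y (X.tens Y)) p) := by
    refine (isUnit_two.map ρ).mul_left_cancel ?_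
    have const : X.D p (-2) = 0 := congrFun grad_neg_two p
    have grad_trace := hF.congr p _ _ hF.map_tr_dg
    have variation := congrFun (two_mul_tr_dΓ hF.comm) p
    have divergence := hF.map_div2_dg p
    simp only [Pi.smul_apply, Pi.sub_apply, smul_eq_mul, grad] at variation divergence ⊢
    rw [← map_mul, variation, map_sub, map_mul, divergence, grad_trace, ← map_mul, ← map_sub,
      Derivation.leibniz, const, smul_zero, add_zero, smul_eq_mul, ← map_mul]
    congr 1
    ring
  have christoffel_term := map_pair_congr (X := X) (X.grad l) trace_dΓ
  rw [pair_smul_left, pair_along] at christoffel_term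
  rw [d_lap hF.comm, map_sub, map_sub, hF.map_pair2_dg, christoffel_term, ← map_sub, ← map_sub]
  congr 1
  ring

theorem map_d_gradSq (l : A) : ρ (d (X.pair (X.grad l) (X.grad l))) =
    ρ (2 * X.pair (X.grad (d l)) (X.grad l)
      + 2 * X.pair2 (X.tensS Y β) fun i j => X.grad l i * X.grad l j) := by
  have d_grad : (fun i => d (X.grad l i)) = X.grad (d l) := funext fun i => hF.comm i l
  have metric := hF.map_pair2_dg fun i j => X.grad l i * X.grad l j
  rw [d_pair, d_grad, map_sub, metric, pair_comm (X.grad l), ← map_sub]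
  congr 1
  ring

/-- Write `Q` for the density. Since `∂ₜl = Δl - Q + b`, the term `2Δ(∂ₜl)` of `∂ₜQ` contributes
`-2ΔQ`, which makes the equation for `Q` a backward one; Bochner's formula completes the squares. -/
theorem map_d_harnackDensity {l b : A} (hb : X.grad b = 0)
    (hl : ρ (d l) = ρ (X.lap l - X.harnackDensity Y β l + b)) :
    ρ (d (X.harnackDensity Y β l) + X.lap (X.harnackDensity Y β l)
      - 2 * X.pair (X.grad (X.harnackDensity Y β l)) (X.grad l)) =
    ρ (2 * X.pair2 (X.tensS Y β + X.hess l) (X.tensS Y β + X.hess l)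
      + 2 * β * Y.ip (X.tens Y - X.pushed Y (X.grad l)) (X.tens Y - X.pushed Y (X.grad l))
      - d β * X.tr (X.pb Y)) := by
  set Q := X.harnackDensity Y β l with hQ
  have d_density : d Q = 2 * d (X.lap l) - d (X.pair (X.grad l) (X.grad l))
      + d (X.tr (X.tensS Y β)) := by
    have d_two : d 2 = 0 := d.map_natCast 2
    rw [hQ, harnackDensity, map_add, map_sub, Derivation.leibniz, d_two, smul_zero, add_zero,
      smul_eq_mul]
  have lap_density : ρ (X.lap Q) = ρ (2 * X.lap (X.lap l)
      - X.lap (X.pair (X.grad l) (X.grad l)) + X.lap (X.tr (X.tensS Y β))) := by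
    rw [hQ, harnackDensity, lap_add, lap_sub, lap_smul_of_grad_eq_zero grad_two]
  have lap_d : ρ (X.lap (d l)) = ρ (X.lap (X.lap l) - X.lap Q) := by
    rw [map_lap_congr hF.congr hl, lap_add, lap_sub, lap_of_grad_eq_zero hb, add_zero]
  have pair_d : ρ (X.pair (X.grad (d l)) (X.grad l)) =
      ρ (X.pair (X.grad (X.lap l)) (X.grad l) - X.pair (X.grad Q) (X.grad l)) := by
    have grad_d := map_pair_congr (X := X) (X.grad l) fun i => hF.congr i _ _ hl
    change ρ (X.pair (X.grad (d l)) _) = ρ (X.pair (X.grad _) _) at grad_d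
    rw [grad_d, grad_add, hb, add_zero, grad_sub, pair_sub_left]
  have evolution_lap := hF.map_d_lap l
  have evolution_gradSq := hF.map_d_gradSq l
  have evolution_trace := hF.map_d_tr_tensS
  have bochner_l := congrArg ρ (bochner (X := X) l)
  rw [pair2_tensS, pair2_pb_mul] at evolution_gradSq
  rw [pair2_add_self, CoordMap.ip_sub_self, d_density]
  rw [pair_comm (X.grad l) (X.grad (X.lap l))] at bochner_l
  simp only [map_sub, map_mul, map_add, map_ofNat]
    at evolution_lap evolution_gradSq evolution_trace lap_d pair_d bochner_l lap_density ⊢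
  linear_combination 2 * evolution_lap - evolution_gradSq + evolution_trace + 2 * lap_d
    - 2 * pair_d + bochner_l - lap_density

/-- Because `2σc = 1`, the constant `nc` is the term `2σ|cg|²` that completes the square. -/
theorem map_adjointHeat_harnack {σ c l v : A} (hv : X.IsKernel d σ c l v)
    (heat : ρ (X.adjointHeat Y β d v) = 0) :
    ρ (X.adjointHeat Y β d (X.harnack Y β σ l v)) =
    ρ (-(2 * σ * (X.pair2 (X.tensS Y β + X.hess l - c • fun i j => X.g i j)
          (X.tensS Y β + X.hess l - c • fun i j => X.g i j)
        + β * Y.ip (X.tens Y - X.pushed Y (X.grad l)) (X.tens Y - X.pushed Y (X.grad l)))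
      - σ * d β * X.tr (X.pb Y)) * v) := by
  set Q := X.harnackDensity Y β l with hQ
  set n : A := ((Fintype.card ι : ℕ) : A) with hn
  set P := σ * Q + l - n with hP
  have hl := hv.map_d_potential heat
  have grad_nat : X.grad n = 0 := funext fun i => (X.D i).map_natCast _
  have grad_nc : X.grad (n * c) = 0 := by
    rw [grad_mul, hv.grad_const, grad_nat, smul_zero, smul_zero, add_zero]
  have density := hF.map_d_harnackDensity grad_nc hl
  have evolution : d P + X.lap P - 2 * X.pair (X.grad P) (X.grad l) =
      σ * (d Q + X.lap Q - 2 * X.pair (X.grad Q) (X.grad l))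
        + (d l - Q + X.lap l - 2 * X.pair (X.grad l) (X.grad l)) := by
    have grad_P : X.grad P = σ • X.grad Q + X.grad l := by
      rw [hP, grad_sub, grad_add, grad_mul, hv.grad_time, grad_nat, smul_zero, add_zero, sub_zero]
    rw [grad_P, hP, map_sub, map_add, Derivation.leibniz, hv.d_time, hn, d.map_natCast, lap_sub,
      lap_add, lap_smul_of_grad_eq_zero hv.grad_time, lap_of_grad_eq_zero grad_nat, pair_add_left,
      pair_smul_left, smul_eq_mul, smul_eq_mul]
    ring
  have two_mul_time : ρ (2 * σ * c) = 1 := by rw [hv.two_mul_time_mul, map_one]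
  have density_eq := congrArg ρ hQ
  have trace : X.tr (X.tensS Y β + X.hess l) = X.tr (X.tensS Y β) + X.lap l := tr_add _ _
  rw [harnack, adjointHeat_mul hv.grad_eq, map_sub, map_mul, heat, mul_zero, zero_sub, evolution,
    pair2_sub_smul_g_self, trace]
  rw [harnackDensity] at density_eq
  simp only [map_sub, map_mul, map_add, map_neg, map_ofNat, map_pow]
    at hl density density_eq two_mul_time ⊢
  linear_combination -ρ v * (ρ σ * density + hl) + 2 * ρ v * density_eq
    + ρ v * (ρ n * ρ c - 2 * ρ (X.lap l) - 2 * ρ (X.tr (X.tensS Y β))) * two_mul_time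

end IsFlow

end CoordMetric

/-! ### Rings of smooth functions on open sets -/

open TopologicalSpace (Opens)

section SmoothFunctions

variable {E : Type*} [NormedAddCommGroup E] [NormedSpace ℝ E]

/-- The algebra of smooth functions on the open set `Ω`. -/
def SmoothFun (Ω : Opens E) : Subalgebra ℝ (Ω → ℝ) where
  carrier := {f | ∃ F : E → ℝ, ContDiffOn ℝ ∞ F Ω ∧ ∀ p : Ω, F p = f p}
  mul_mem' := fun ⟨F, hF, hf⟩ ⟨G, hG, hg⟩ =>
    ⟨fun p => F p * G p, hF.mul hG, fun p => congrArg₂ (· * ·) (hf p) (hg p)⟩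
  add_mem' := fun ⟨F, hF, hf⟩ ⟨G, hG, hg⟩ =>
    ⟨fun p => F p + G p, hF.add hG, fun p => congrArg₂ (· + ·) (hf p) (hg p)⟩
  algebraMap_mem' c := ⟨fun _ => c, contDiffOn_const, fun _ => rfl⟩

namespace SmoothFun

variable {Ω : Opens E}

/-- The smooth function given by a function on the whole space. -/
def mk (F : E → ℝ) (hF : ContDiffOn ℝ ∞ F Ω) : SmoothFun Ω := ⟨fun p => F p, F, hF, fun _ => rfl⟩

/-- Some function on the whole space which restricts to the given one. -/
def extension (f : SmoothFun Ω) : E → ℝ := f.2.choose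

lemma contDiffOn_extension (f : SmoothFun Ω) : ContDiffOn ℝ ∞ (extension f) Ω :=
  f.2.choose_spec.1

lemma extension_apply (f : SmoothFun Ω) (p : Ω) : extension f p = f.1 p := f.2.choose_spec.2 p

lemma contDiffAt_extension (f : SmoothFun Ω) (p : Ω) : ContDiffAt ℝ ∞ (extension f) p :=
  (contDiffOn_extension f).contDiffAt (Ω.isOpen.mem_nhds p.2)

lemma differentiableAt_extension (f : SmoothFun Ω) (p : Ω) :
    DifferentiableAt ℝ (extension f) p :=
  (contDiffAt_extension f p).differentiableAt (by simp)

lemma extension_eventuallyEq {f : SmoothFun Ω} {F : E → ℝ} (h : ∀ p : Ω, f.1 p = F p) (p : Ω) :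
    extension f =ᶠ[nhds (p : E)] F :=
  Filter.eventually_of_mem (Ω.isOpen.mem_nhds p.2) fun q hq =>
    (extension_apply f ⟨q, hq⟩).trans (h ⟨q, hq⟩)

lemma fderiv_extension {f : SmoothFun Ω} {F : E → ℝ} (h : ∀ p : Ω, f.1 p = F p) (p : Ω) :
    fderiv ℝ (extension f) p = fderiv ℝ F p :=
  (extension_eventuallyEq h p).fderiv_eq

/-- The derivative in the direction `v` as a derivation. -/
def D (v : E) : Derivation ℝ (SmoothFun Ω) (SmoothFun Ω) :=
  Derivation.mk'
    { toFun := fun f => mk (fun p => fderiv ℝ (extension f) p v)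
        (((contDiffOn_extension f).fderiv_of_isOpen Ω.isOpen (by simp)).clm_apply contDiffOn_const)
      map_add' := fun f g => Subtype.ext <| funext fun p => by
        have sum (q : Ω) : (f + g).1 q = (extension f + extension g) q :=
          congrArg₂ (· + ·) (extension_apply f q).symm (extension_apply g q).symm
        change fderiv ℝ (extension (f + g)) p v = _
        rw [fderiv_extension sum,
          fderiv_add (differentiableAt_extension f p) (differentiableAt_extension g p)]
        rfl
      map_smul' := fun c f => Subtype.ext <| funext fun p => by
        have multiple (q : Ω) : (c • f).1 q = (c • extension f) q :=
          congrArg (c • ·) (extension_apply f q).symm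
        change fderiv ℝ (extension (c • f)) p v = _
        rw [fderiv_extension multiple, fderiv_const_smul (differentiableAt_extension f p)]
        rfl }
    fun f g => Subtype.ext <| funext fun p => by
      have product (q : Ω) : (f * g).1 q = (extension f * extension g) q :=
        congrArg₂ (· * ·) (extension_apply f q).symm (extension_apply g q).symm
      change fderiv ℝ (extension (f * g)) p v = _
      rw [fderiv_extension product,
        fderiv_mul (differentiableAt_extension f p) (differentiableAt_extension g p),
        extension_apply, extension_apply]
      rfl

lemma D_apply {v : E} {f : SmoothFun Ω} {F : E → ℝ} (h : ∀ p : Ω, f.1 p = F p) (p : Ω) :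
    (D v f).1 p = fderiv ℝ F p v :=
  congrArg (· v) (fderiv_extension h p)

lemma D_comm (v w : E) (f : SmoothFun Ω) : D v (D w f) = D w (D v f) := by
  refine Subtype.ext (funext fun p => ?_)
  have differentiable : DifferentiableAt ℝ (fderiv ℝ (extension f)) p :=
    ((contDiffAt_extension f p).fderiv_right (m := 1) (by norm_cast)).differentiableAt (by simp)
  have second (v w : E) :
      (D v (D w f)).1 p = fderiv ℝ (fderiv ℝ (extension f)) p v w := by
    rw [D_apply (F := fun q => fderiv ℝ (extension f) q w) fun _ => rfl,
      fderiv_clm_apply differentiable (differentiableAt_const w)]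
    simp
  rw [second, second]
  exact (contDiffAt_extension f p).isSymmSndFDerivAt
    (by simpa using WithTop.coe_le_coe.2 (le_top (a := (2 : ℕ∞)))) v w

lemma isUnit_of_forall_ne_zero {f : SmoothFun Ω} (h : ∀ p, f.1 p ≠ 0) : IsUnit f := by
  have nonzero (p : E) (hp : p ∈ Ω) : extension f p ≠ 0 := by
    rw [extension_apply f ⟨p, hp⟩]
    exact h _
  refine IsUnit.of_mul_eq_one (mk ((extension f)⁻¹) ((contDiffOn_extension f).inv nonzero)) ?_
  refine Subtype.ext (funext fun p => ?_)
  change f.1 p * (extension f p)⁻¹ = 1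
  rw [extension_apply, mul_inv_cancel₀ (h p)]

/-- Evaluation at a point. -/
def ev (p : Ω) : SmoothFun Ω →+* ℝ :=
  (Pi.evalRingHom (fun _ : Ω => ℝ) p).comp (SmoothFun Ω).val.toRingHom

lemma ev_apply (p : Ω) (f : SmoothFun Ω) : ev p f = f.1 p := rfl

end SmoothFun

end SmoothFunctions

section SpaceTime

open SmoothFun

variable {n : ℕ} {Ω : Opens (ℝ × EuclideanSpace ℝ (Fin n))}

/-- The function `F` of time and space represents the element `f` of the ring of smooth functions.
This is how identities in the ring are transferred to functions. -/
def Rep (f : SmoothFun Ω) (F : ℝ → EuclideanSpace ℝ (Fin n) → ℝ) : Prop :=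
  ∀ p : Ω, f.1 p = F p.1.1 p.1.2

/-- The spatial partial derivative in the direction `i`. -/
def Dx (i : Fin n) : Derivation ℝ (SmoothFun Ω) (SmoothFun Ω) :=
  D (0, EuclideanSpace.single i 1)

/-- The time derivative. -/
def Dt : Derivation ℝ (SmoothFun Ω) (SmoothFun Ω) := D (1, 0)

variable {f g : SmoothFun Ω} {F G : ℝ → EuclideanSpace ℝ (Fin n) → ℝ}

namespace Rep

lemma hasFDerivAt (h : Rep f F) (p : Ω) :
    HasFDerivAt (fun q : ℝ × EuclideanSpace ℝ (Fin n) => F q.1 q.2)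
      (fderiv ℝ (fun q : ℝ × EuclideanSpace ℝ (Fin n) => F q.1 q.2) p) p :=
  ((differentiableAt_extension f p).congr_of_eventuallyEq
    (extension_eventuallyEq (F := fun q : ℝ × _ => F q.1 q.2) h p).symm).hasFDerivAt

lemma hasDerivAt (h : Rep f F) (p : Ω) : HasDerivAt (fun s => F s p.1.2) ((Dt f).1 p) p.1.1 := by
  have line : HasDerivAt (fun s : ℝ => (s, p.1.2)) ((1 : ℝ), (0 : EuclideanSpace ℝ (Fin n)))
      p.1.1 :=
    (hasDerivAt_id _).prodMk (hasDerivAt_const _ _)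
  rw [Dt, D_apply (F := fun q : ℝ × _ => F q.1 q.2) h]
  exact HasFDerivAt.comp_hasDerivAt (x := p.1.1) (h.hasFDerivAt p) line

lemma dt (h : Rep f F) : Rep (Dt f) fun t u => deriv (fun s => F s u) t :=
  fun p => (h.hasDerivAt p).deriv.symm

lemma dx (h : Rep f F) (i : Fin n) : Rep (Dx i f) fun t u => pd i (F t) u := fun p => by
  have slice := (h.hasFDerivAt p).comp (f := fun u => (p.1.1, u)) p.1.2
    (hasFDerivAt_prodMk_right _ _)
  have slice_fderiv : fderiv ℝ (F p.1.1) p.1.2 = _ := slice.fderiv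
  rw [Dx, D_apply (F := fun q : ℝ × _ => F q.1 q.2) h]
  exact (congrArg (· (EuclideanSpace.single i 1)) slice_fderiv).symm

lemma congr (h : Rep f F) (hFG : ∀ p ∈ Ω, F p.1 p.2 = G p.1 p.2) : Rep f G :=
  fun p => (h p).trans (hFG p.1 p.2)

lemma add (hf : Rep f F) (hg : Rep g G) : Rep (f + g) fun t u => F t u + G t u :=
  fun p => congrArg₂ (· + ·) (hf p) (hg p)

lemma neg (hf : Rep f F) : Rep (-f) fun t u => -F t u :=
  fun p => congrArg (- ·) (hf p)

lemma sub (hf : Rep f F) (hg : Rep g G) : Rep (f - g) fun t u => F t u - G t u :=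
  fun p => congrArg₂ (· - ·) (hf p) (hg p)

lemma mul (hf : Rep f F) (hg : Rep g G) : Rep (f * g) fun t u => F t u * G t u :=
  fun p => congrArg₂ (· * ·) (hf p) (hg p)

lemma smul (c : ℝ) (hf : Rep f F) : Rep (c • f) fun t u => c * F t u :=
  fun p => congrArg (c * ·) (hf p)

lemma sum {ι : Type*} {s : Finset ι} {f : ι → SmoothFun Ω}
    {F : ι → ℝ → EuclideanSpace ℝ (Fin n) → ℝ} (h : ∀ i, Rep (f i) (F i)) :
    Rep (∑ i ∈ s, f i) fun t u => ∑ i ∈ s, F i t u := fun p =>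
  (map_sum (ev p) f s).trans (Finset.sum_congr rfl fun i _ => h i p)

end Rep

lemma rep_mk (hF : ContDiffOn ℝ ∞ (fun q : ℝ × EuclideanSpace ℝ (Fin n) => F q.1 q.2) Ω) :
    Rep (SmoothFun.mk (fun q : ℝ × EuclideanSpace ℝ (Fin n) => F q.1 q.2) hF) F := fun _ => rfl

end SpaceTime

/-! ### Families of metrics in coordinates -/

section MetricFamilies

variable {n : ℕ} {Ω : Opens (ℝ × EuclideanSpace ℝ (Fin n))}

/-- A smooth family of nondegenerate symmetric matrices on the open set `Ω` of space-time. -/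
structure IsMetricFamily (Ω : Opens (ℝ × EuclideanSpace ℝ (Fin n)))
    (G : ℝ → EuclideanSpace ℝ (Fin n) → Matrix (Fin n) (Fin n) ℝ) : Prop where
  smooth : ∀ i j, ContDiffOn ℝ ∞ (fun q : ℝ × EuclideanSpace ℝ (Fin n) => G q.1 q.2 i j) Ω
  symm : ∀ q ∈ Ω, (G q.1 q.2).IsSymm
  det_ne_zero : ∀ q ∈ Ω, (G q.1 q.2).det ≠ 0

namespace IsMetricFamily

variable {G : ℝ → EuclideanSpace ℝ (Fin n) → Matrix (Fin n) (Fin n) ℝ}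

/-- The family as a metric over the ring of smooth functions on `Ω`. -/
def coordMetric (hG : IsMetricFamily Ω G) : CoordMetric (Fin n) (SmoothFun Ω) where
  D := Dx
  g := Matrix.of fun i j => SmoothFun.mk _ (hG.smooth i j)
  D_comm _ _ _ := SmoothFun.D_comm _ _ _
  g_symm := Matrix.IsSymm.ext fun i j =>
    Subtype.ext (funext fun p : Ω => (hG.symm p.1 p.2).apply i j)
  isUnit_det := SmoothFun.isUnit_of_forall_ne_zero fun p =>
    ((SmoothFun.ev p).map_det _).trans_ne (hG.det_ne_zero p.1 p.2)

variable (hG : IsMetricFamily Ω G) {f h : SmoothFun Ω}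
  {F H : ℝ → EuclideanSpace ℝ (Fin n) → ℝ} {S : Fin n → Fin n → SmoothFun Ω}
  {S' : ℝ → EuclideanSpace ℝ (Fin n) → Matrix (Fin n) (Fin n) ℝ}

include hG

lemma rep_g (i j : Fin n) : Rep (hG.coordMetric.g i j) fun t u => G t u i j := fun _ => rfl

lemma rep_inv (i j : Fin n) : Rep (hG.coordMetric.g⁻¹ i j) fun t u => (G t u)⁻¹ i j := fun p => by
  have inverse := congrArg (fun M : Matrix (Fin n) (Fin n) (SmoothFun Ω) =>
    M.map (SmoothFun.ev p)) hG.coordMetric.inv_mul_g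
  simp only [Matrix.map_mul] at inverse
  rw [Matrix.map_one _ (map_zero _) (map_one _)] at inverse
  exact congrFun (congrFun (Matrix.inv_eq_left_inv inverse).symm i) j

lemma rep_Γ (i j k : Fin n) :
    Rep (hG.coordMetric.Γ i k j) fun t u => christoffel (G t) k i j u := by
  have factor_inside : Rep (hG.coordMetric.Γ i k j) fun t u => ∑ l, (G t u)⁻¹ k l * (1 / 2 *
      (pd i (fun z => G t z j l) u + pd j (fun z => G t z i l) u - pd l (fun z => G t z i j) u)) :=
    Rep.sum fun l => (hG.rep_inv k l).mul (Rep.smul (1 / 2)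
      ((((hG.rep_g j l).dx i).add ((hG.rep_g i l).dx j)).sub ((hG.rep_g i j).dx l)))
  refine factor_inside.congr fun p _ => ?_
  rw [christoffel, Finset.mul_sum]
  exact Finset.sum_congr rfl fun l _ => mul_left_comm _ _ _

lemma rep_hess (hf : Rep f F) (i j : Fin n) :
    Rep (hG.coordMetric.hess f i j) fun t u => hessian (G t) (F t) u i j :=
  ((hf.dx j).dx i).sub (Rep.sum fun k => (hG.rep_Γ i j k).mul (hf.dx k))

lemma rep_tr (hS : ∀ i j, Rep (S i j) fun t u => S' t u i j) :
    Rep (hG.coordMetric.tr S) fun t u => traceWith (G t u) (S' t u) :=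
  Rep.sum fun i => Rep.sum fun j => (hG.rep_inv i j).mul (hS i j)

lemma rep_lap (hf : Rep f F) :
    Rep (hG.coordMetric.lap f) fun t u => traceWith (G t u) (hessian (G t) (F t) u) :=
  hG.rep_tr (hG.rep_hess hf)

lemma rep_pair (hf : Rep f F) (hh : Rep h H) :
    Rep (hG.coordMetric.pair (hG.coordMetric.grad f) (hG.coordMetric.grad h))
      fun t u => gradPairing (G t) (F t) (H t) u :=
  hG.rep_tr (S' := fun t u => Matrix.of fun i j => pd i (F t) u * pd j (H t) u)
    fun i j => (hf.dx i).mul (hh.dx j)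

lemma rep_pair2 (hS : ∀ i j, Rep (S i j) fun t u => S' t u i j) :
    Rep (hG.coordMetric.pair2 S S) fun t u => tensorNormSq (G t u) (S' t u) := by
  have nested : Rep (hG.coordMetric.pair2 S S) fun t u => ∑ i, ∑ k, (G t u)⁻¹ i k *
      ∑ j, ∑ l, (G t u)⁻¹ j l * (S' t u i j * S' t u k l) :=
    Rep.sum fun i => Rep.sum fun k => (hG.rep_inv i k).mul
      (Rep.sum fun j => Rep.sum fun l => (hG.rep_inv j l).mul ((hS i j).mul (hS k l)))
  refine nested.congr fun p _ => ?_
  simp only [tensorNormSq, Finset.mul_sum]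
  refine Finset.sum_congr rfl fun i _ => Finset.sum_comm.trans ?_
  exact Finset.sum_congr rfl fun j _ => Finset.sum_congr rfl fun k _ =>
    Finset.sum_congr rfl fun l _ => by ring

lemma rep_ric (i j : Fin n) : Rep (hG.coordMetric.ric i j) fun t u => ricci (G t) u i j := by
  set X := hG.coordMetric
  have in_coordinates : X.ric i j =
      ∑ k, (X.D k (X.Γ i k j) - X.D j (X.Γ i k k))
        + ∑ k, ∑ l, (X.Γ k k l * X.Γ i l j - X.Γ j k l * X.Γ i l k) := by
    simp only [CoordMetric.ric, CoordMetric.curv, Matrix.add_apply, Matrix.sub_apply,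
      Matrix.map_apply, Matrix.mul_apply, Finset.sum_add_distrib, Finset.sum_sub_distrib,
      CoordMetric.Γ_symm j i, CoordMetric.Γ_symm _ i]
    ring
  rw [in_coordinates]
  exact (Rep.sum fun k => ((hG.rep_Γ i j k).dx k).sub ((hG.rep_Γ i k k).dx j)).add
    (Rep.sum fun k => Rep.sum fun l =>
      ((hG.rep_Γ k l k).mul (hG.rep_Γ i j l)).sub ((hG.rep_Γ j l k).mul (hG.rep_Γ i k l)))

end IsMetricFamily

end MetricFamilies

/-! ### Metrics and maps in charts -/

section CoordinateCalculus

variable {k : ℕ}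

lemma map_eq_sum_single {V : Type*} [AddCommGroup V] [Module ℝ V] [TopologicalSpace V]
    (L : EuclideanSpace ℝ (Fin k) →L[ℝ] V) (w : EuclideanSpace ℝ (Fin k)) :
    L w = ∑ a, w a • L (EuclideanSpace.single a 1) := by
  conv_lhs => rw [← (EuclideanSpace.basisFun (Fin k) ℝ).sum_repr w, map_sum]
  simp only [map_smul, EuclideanSpace.basisFun_apply, EuclideanSpace.basisFun_repr]

lemma bilin_sum_smul {E : Type*} [NormedAddCommGroup E] [NormedSpace ℝ E]
    (B : E →L[ℝ] E →L[ℝ] ℝ) (v : Fin k → E) (c d : Fin k → ℝ) :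
    B (∑ a, c a • v a) (∑ b, d b • v b) =
      c ⬝ᵥ (Matrix.of fun a b => B (v a) (v b)).mulVec d := by
  simp only [map_sum, map_smul, sum_apply, smul_apply, smul_eq_mul, dotProduct, Matrix.mulVec,
    Matrix.of_apply, Finset.mul_sum]
  rw [Finset.sum_comm]
  exact Finset.sum_congr rfl fun a _ => Finset.sum_congr rfl fun b _ => by ring

variable {E : Type*} [NormedAddCommGroup E] [NormedSpace ℝ E] {Φ : E → EuclideanSpace ℝ (Fin k)}
  {p : E}

lemma fderiv_euclidean_apply (hΦ : DifferentiableAt ℝ Φ p) (w : E) (a : Fin k) :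
    fderiv ℝ (fun q => Φ q a) p w = fderiv ℝ Φ p w a :=
  congrArg (fun L : E →L[ℝ] ℝ => L w)
    ((PiLp.hasFDerivAt_apply (𝕜 := ℝ) 2 (Φ p) a).comp p hΦ.hasFDerivAt).fderiv

lemma fderiv_comp_eq_sum_pd {f : EuclideanSpace ℝ (Fin k) → ℝ}
    (hf : DifferentiableAt ℝ f (Φ p)) (hΦ : DifferentiableAt ℝ Φ p) (w : E) :
    fderiv ℝ (fun q => f (Φ q)) p w = ∑ a, fderiv ℝ (fun q => Φ q a) p w * pd a f (Φ p) := by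
  rw [fderiv_fun_comp p hf hΦ, ContinuousLinearMap.comp_apply, map_eq_sum_single]
  simp only [fderiv_euclidean_apply hΦ, smul_eq_mul, pd]

end CoordinateCalculus

section Charts

variable {k : ℕ} {N : Type*} [TopologicalSpace N] [ChartedSpace (EuclideanSpace ℝ (Fin k)) N]
  {e : OpenPartialHomeomorph N (EuclideanSpace ℝ (Fin k))}

lemma mdifferentiable_of_mem_charts (he : e ∈ charts k N) : e.MDifferentiable (𝓡 k) (𝓡 k) :=
  ⟨(contMDiffOn_of_mem_maximalAtlas he).mdifferentiableOn (by simp),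
    (contMDiffOn_symm_of_mem_maximalAtlas he).mdifferentiableOn (by simp)⟩

variable [IsManifold (𝓡 k) ∞ N]

lemma contMDiffOn_coordinateField (he : e ∈ charts k N) (v : EuclideanSpace ℝ (Fin k)) :
    ContMDiffOn (𝓡 k) (𝓡 k).tangent ∞ (fun u => (⟨e.symm u, mfderiv (𝓡 k) (𝓡 k) e.symm u v⟩ :
      TangentBundle (𝓡 k) N)) e.target := by
  have tangentMap_smooth := (contMDiffOn_symm_of_mem_maximalAtlas he).contMDiffOn_tangentMapWithin
    (m := ∞) (by simp) e.open_target.uniqueMDiffOn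
  have constant_field : ContMDiff (𝓡 k) (𝓡 k).tangent ∞ (fun u : EuclideanSpace ℝ (Fin k) =>
      (⟨u, v⟩ : TangentBundle (𝓡 k) (EuclideanSpace ℝ (Fin k)))) :=
    contMDiff_vectorSpace_iff_contDiff.2 contDiff_const
  refine (tangentMap_smooth.comp constant_field.contMDiffOn fun u hu => hu).congr fun u hu => ?_
  simp only [Function.comp, tangentMapWithin]
  rw [mfderivWithin_of_isOpen e.open_target hu]

variable (γ : RMetric k N)

lemma metricIn_contDiffOn (he : e ∈ charts k N) (a b : Fin k) :
    ContDiffOn ℝ ∞ (fun u => metricIn γ e u a b) e.target := by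
  rw [← contMDiffOn_iff_contDiffOn]
  intro u hu
  have section_smooth : ContMDiffWithinAt (𝓡 k) ((𝓡 k).prod 𝓘(ℝ, ℝ)) ∞ (fun u =>
      (Bundle.TotalSpace.mk' ℝ (E := Bundle.Trivial N ℝ) (e.symm u) (metricIn γ e u a b)))
      e.target u :=
    ContMDiffWithinAt.clm_bundle_apply₂ (F₁ := EuclideanSpace ℝ (Fin k))
      (F₂ := EuclideanSpace ℝ (Fin k))
      (γ.contMDiff.contMDiffAt.comp_contMDiffWithinAt u
        (contMDiffOn_symm_of_mem_maximalAtlas he u hu))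
      (contMDiffOn_coordinateField he _ u hu) (contMDiffOn_coordinateField he _ u hu)
  rw [Bundle.contMDiffWithinAt_totalSpace] at section_smooth
  exact section_smooth.2

lemma metricIn_isSymm (e : OpenPartialHomeomorph N (EuclideanSpace ℝ (Fin k)))
    (u : EuclideanSpace ℝ (Fin k)) : (metricIn γ e u).IsSymm :=
  Matrix.IsSymm.ext fun _ _ => γ.symm _ _ _

/-- The value of a metric at a point as a bilinear form on the model space, to which the tangent
space is definitionally equal. -/
def innerAt (γ : RMetric k N) (y : N) :
    EuclideanSpace ℝ (Fin k) →L[ℝ] EuclideanSpace ℝ (Fin k) →L[ℝ] ℝ := γ.inner y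

/-- The derivative of the inverse of a chart, as an endomorphism of the model space; its columns
are the coordinate vector fields. -/
def frameAt (e : OpenPartialHomeomorph N (EuclideanSpace ℝ (Fin k)))
    (u : EuclideanSpace ℝ (Fin k)) : EuclideanSpace ℝ (Fin k) →L[ℝ] EuclideanSpace ℝ (Fin k) :=
  mfderiv (𝓡 k) (𝓡 k) e.symm u

lemma innerAt_frameAt (u v w : EuclideanSpace ℝ (Fin k)) :
    innerAt γ (e.symm u) (frameAt e u v) (frameAt e u w) =
      (v : Fin k → ℝ) ⬝ᵥ (metricIn γ e u).mulVec w := by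
  rw [map_eq_sum_single (frameAt e u) v, map_eq_sum_single (frameAt e u) w, bilin_sum_smul]
  rfl

lemma metricIn_posDef (he : e ∈ charts k N) {u : EuclideanSpace ℝ (Fin k)} (hu : u ∈ e.target) :
    (metricIn γ e u).PosDef := by
  refine .of_dotProduct_mulVec_pos (metricIn_isSymm γ e u) fun x hx => ?_
  have frame_ne_zero : frameAt e u (WithLp.toLp 2 x) ≠ 0 :=
    ((mdifferentiable_of_mem_charts he).symm.mfderiv_injective hu).ne_iff' (map_zero _) |>.2
      ((WithLp.toLp_eq_zero 2).not.2 hx)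
  exact (γ.pos (e.symm u) _ frame_ne_zero).trans_eq (innerAt_frameAt γ u _ _)

end Charts

section MapsInCharts

variable {n k : ℕ} {M : Type*} [TopologicalSpace M]
  {N : Type*} [TopologicalSpace N] [ChartedSpace (EuclideanSpace ℝ (Fin k)) N]
  {φ : M → N} {e : OpenPartialHomeomorph M (EuclideanSpace ℝ (Fin n))}
  {e' : OpenPartialHomeomorph N (EuclideanSpace ℝ (Fin k))} {u : EuclideanSpace ℝ (Fin n)}

lemma differentiableAt_inCharts (he' : e' ∈ charts k N)
    (hφ : MDifferentiableAt (𝓡 n) (𝓡 k) (φ ∘ e.symm) u) (hu : φ (e.symm u) ∈ e'.source) :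
    DifferentiableAt ℝ (fun z => e' (φ (e.symm z))) u :=
  (((mdifferentiable_of_mem_charts he').mdifferentiableAt hu).comp u hφ).differentiableAt

lemma mfderiv_comp_symm_apply (he' : e' ∈ charts k N)
    (hφ : MDifferentiableAt (𝓡 n) (𝓡 k) (φ ∘ e.symm) u) (hu : φ (e.symm u) ∈ e'.source)
    (w : EuclideanSpace ℝ (Fin n)) :
    mfderiv (𝓡 n) (𝓡 k) (φ ∘ e.symm) u w =
      frameAt e' (e' (φ (e.symm u))) (fderiv ℝ (fun z => e' (φ (e.symm z))) u w) := by
  have through_chart : φ ∘ e.symm =ᶠ[nhds u] e'.symm ∘ fun z => e' (φ (e.symm z)) := by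
    filter_upwards [hφ.continuousAt.eventually (e'.open_source.mem_nhds hu)] with z hz
    exact (e'.left_inv hz).symm
  rw [through_chart.mfderiv_eq, mfderiv_comp u
    ((mdifferentiable_of_mem_charts he').mdifferentiableAt_symm (e'.map_source hu))
    (differentiableAt_inCharts he' hφ hu).mdifferentiableAt, mfderiv_eq_fderiv]
  rfl

/-- The Jacobian matrix of the map `φ`, read in the charts `e` and `e'`. -/
def jacobian (φ : M → N) (e : OpenPartialHomeomorph M (EuclideanSpace ℝ (Fin n)))
    (e' : OpenPartialHomeomorph N (EuclideanSpace ℝ (Fin k))) (u : EuclideanSpace ℝ (Fin n)) :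
    Matrix (Fin k) (Fin n) ℝ :=
  Matrix.of fun a i => pd i (mapComp φ e e' a) u

variable [IsManifold (𝓡 k) ∞ N] (γ : RMetric k N)

lemma pullbackIn_eq (he' : e' ∈ charts k N)
    (hφ : MDifferentiableAt (𝓡 n) (𝓡 k) (φ ∘ e.symm) u) (hu : φ (e.symm u) ∈ e'.source) :
    pullbackIn γ φ e u =
      (jacobian φ e e' u).transpose * metricIn γ e' (e' (φ (e.symm u))) * jacobian φ e e' u := by
  have column (i : Fin n) : (fderiv ℝ (fun z => e' (φ (e.symm z))) u (EuclideanSpace.single i 1) :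
      Fin k → ℝ) = fun a => jacobian φ e e' u a i :=
    funext fun a => (fderiv_euclidean_apply (differentiableAt_inCharts he' hφ hu) _ a).symm
  ext i j
  rw [Matrix.mul_assoc]
  have by_frames := innerAt_frameAt γ (e := e') (e' (φ (e.symm u)))
    (fderiv ℝ (fun z => e' (φ (e.symm z))) u (EuclideanSpace.single i 1))
    (fderiv ℝ (fun z => e' (φ (e.symm z))) u (EuclideanSpace.single j 1))
  rw [e'.left_inv hu, ← mfderiv_comp_symm_apply he' hφ hu, ← mfderiv_comp_symm_apply he' hφ hu,
    column, column] at by_frames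
  exact by_frames

end MapsInCharts

/-! ### Change of chart -/

section Congruence

variable {n : ℕ}

lemma traceWith_eq_trace (G A : Matrix (Fin n) (Fin n) ℝ) :
    traceWith G A = (G⁻¹ * A.transpose).trace := rfl

lemma traceWith_congruence (G A : Matrix (Fin n) (Fin n) ℝ) {P : Matrix (Fin n) (Fin n) ℝ}
    (hP : IsUnit P.det) :
    traceWith (P.transpose * G * P) (P.transpose * A * P) = traceWith G A := by
  have hPt : IsUnit P.transpose.det := by rwa [Matrix.det_transpose]
  have conjugate : (P.transpose * G * P)⁻¹ * (P.transpose * A * P).transpose =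
      P⁻¹ * (G⁻¹ * A.transpose * P) := by
    simp only [Matrix.mul_inv_rev, Matrix.transpose_mul, Matrix.transpose_transpose,
      Matrix.mul_assoc, Matrix.nonsing_inv_mul_cancel_left _ _ hPt]
  rw [traceWith_eq_trace, traceWith_eq_trace, conjugate, Matrix.trace_mul_comm,
    Matrix.mul_nonsing_inv_cancel_right _ _ hP]

lemma hasDerivAt_mul_mul_apply {A : ℝ → Matrix (Fin n) (Fin n) ℝ} {A' : Matrix (Fin n) (Fin n) ℝ}
    {t : ℝ} (hA : ∀ i j, HasDerivAt (fun s => A s i j) (A' i j) t)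
    (P Q : Matrix (Fin n) (Fin n) ℝ) (i j : Fin n) :
    HasDerivAt (fun s => (P * A s * Q) i j) ((P * A' * Q) i j) t := by
  simp only [Matrix.mul_apply]
  exact .fun_sum fun b _ => (HasDerivAt.fun_sum fun a _ => (hA a b).const_mul _).mul_const _

end Congruence

section TwoCharts

variable {n : ℕ} {M : Type*} [TopologicalSpace M] [ChartedSpace (EuclideanSpace ℝ (Fin n)) M]
  {e e₂ : OpenPartialHomeomorph M (EuclideanSpace ℝ (Fin n))}
  (he : e ∈ charts n M) (he₂ : e₂ ∈ charts n M) {x : M} (hx : x ∈ e.source) (hx₂ : x ∈ e₂.source)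
include he he₂ hx hx₂

lemma pd_change {f : M → ℝ} (hf : DifferentiableAt ℝ (f ∘ e₂.symm) (e₂ x)) (i : Fin n) :
    pd i (f ∘ e.symm) (e x) =
      ∑ a, jacobian id e e₂ (e x) a i * pd a (f ∘ e₂.symm) (e₂ x) := by
  have mdiff_symm := (mdifferentiable_of_mem_charts he).mdifferentiableAt_symm (e.map_source hx)
  have source : e.symm (e x) ∈ e₂.source := by rwa [e.left_inv hx]
  have transition := differentiableAt_inCharts (φ := id) (e := e) (u := e x) he₂ mdiff_symm source
  have through_chart : f ∘ e.symm =ᶠ[nhds (e x)] fun z => (f ∘ e₂.symm) (e₂ (e.symm z)) := by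
    filter_upwards [mdiff_symm.continuousAt.eventually (e₂.open_source.mem_nhds source)] with z hz
    exact congrArg f (e₂.left_inv hz).symm
  have chain := fderiv_comp_eq_sum_pd (p := e x) (f := f ∘ e₂.symm)
    (by rwa [id, e.left_inv hx]) transition (EuclideanSpace.single i 1)
  rw [id, e.left_inv hx] at chain
  rw [pd, through_chart.fderiv_eq]
  exact chain

variable [IsManifold (𝓡 n) ∞ M] (g : RMetric n M)

lemma metricIn_change : metricIn g e (e x) =
    (jacobian id e e₂ (e x)).transpose * metricIn g e₂ (e₂ x) * jacobian id e e₂ (e x) := by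
  have pullback_id := pullbackIn_eq (φ := id) (e := e) (u := e x) g he₂
    ((mdifferentiable_of_mem_charts he).mdifferentiableAt_symm (e.map_source hx))
    (by rwa [id, e.left_inv hx])
  rwa [id, e.left_inv hx] at pullback_id

lemma traceWith_change (A : Matrix (Fin n) (Fin n) ℝ) :
    traceWith (metricIn g e (e x))
        ((jacobian id e e₂ (e x)).transpose * A * jacobian id e e₂ (e x)) =
      traceWith (metricIn g e₂ (e₂ x)) A := by
  have det_ne_zero := (metricIn_posDef g he (e.map_source hx)).det_pos.ne'
  rw [metricIn_change he he₂ hx hx₂ g] at det_ne_zero ⊢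
  rw [Matrix.det_mul] at det_ne_zero
  exact traceWith_congruence _ A (isUnit_iff_ne_zero.2 (right_ne_zero_of_mul det_ne_zero))

lemma gradPairing_change {f : M → ℝ} (hf : DifferentiableAt ℝ (f ∘ e₂.symm) (e₂ x)) :
    gradPairing (metricIn g e) (f ∘ e.symm) (f ∘ e.symm) (e x) =
      gradPairing (metricIn g e₂) (f ∘ e₂.symm) (f ∘ e₂.symm) (e₂ x) := by
  rw [gradPairing, gradPairing, ← traceWith_change he he₂ hx hx₂ g]
  congr 1
  ext i j
  simp only [Matrix.of_apply, pd_change he he₂ hx hx₂ hf, Matrix.mul_apply,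
    Matrix.transpose_apply, Finset.sum_mul, Finset.mul_sum]
  exact Finset.sum_congr rfl fun b _ => Finset.sum_congr rfl fun a _ => by ring

end TwoCharts

/-! ### Time-dependent maps and the flow in a chart -/

section ChartDomain

variable {n : ℕ} {M : Type*} [TopologicalSpace M] {J : Set ℝ}

/-- The times in `J` and the coordinates of the chart `e`, as an open set of space-time. -/
def chartDomain (hJ : IsOpen J) (e : OpenPartialHomeomorph M (EuclideanSpace ℝ (Fin n))) :
    Opens (ℝ × EuclideanSpace ℝ (Fin n)) :=
  ⟨J ×ˢ e.target, hJ.prod e.open_target⟩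

variable [ChartedSpace (EuclideanSpace ℝ (Fin n)) M]
  {e : OpenPartialHomeomorph M (EuclideanSpace ℝ (Fin n))} (he : e ∈ charts n M)
  {F : Type*} [NormedAddCommGroup F] [NormedSpace ℝ F]
  {P : Type*} [TopologicalSpace P] [ChartedSpace F P] {f : ℝ → M → P}
  (hf : ContMDiffOn (𝓘(ℝ, ℝ).prod (𝓡 n)) 𝓘(ℝ, F) ∞ (fun p : ℝ × M => f p.1 p.2) (J ×ˢ Set.univ))
include he hf

lemma contMDiffOn_inChart : ContMDiffOn 𝓘(ℝ, ℝ × EuclideanSpace ℝ (Fin n)) 𝓘(ℝ, F) ∞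
    (fun q : ℝ × EuclideanSpace ℝ (Fin n) => f q.1 (e.symm q.2)) (J ×ˢ e.target) := by
  have chart_smooth : ContMDiffOn 𝓘(ℝ, ℝ × EuclideanSpace ℝ (Fin n)) (𝓘(ℝ, ℝ).prod (𝓡 n)) ∞
      (fun q : ℝ × EuclideanSpace ℝ (Fin n) => (q.1, e.symm q.2)) (J ×ˢ e.target) :=
    contDiff_fst.contMDiff.contMDiffOn.prodMk
      ((contMDiffOn_symm_of_mem_maximalAtlas he).comp contDiff_snd.contMDiff.contMDiffOn
        fun q hq => hq.2)
  exact hf.comp chart_smooth fun q hq => ⟨hq.1, trivial⟩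

lemma mdifferentiableAt_inChart (hJ : IsOpen J) {t : ℝ} (ht : t ∈ J)
    {u : EuclideanSpace ℝ (Fin n)} (hu : u ∈ e.target) :
    MDifferentiableAt (𝓡 n) 𝓘(ℝ, F) (f t ∘ e.symm) u := by
  have joint := ((contMDiffOn_inChart he hf).contMDiffAt
    ((hJ.prod e.open_target).mem_nhds (x := (t, u)) ⟨ht, hu⟩)).mdifferentiableAt (by simp)
  have slice : MDifferentiableAt (𝓡 n) 𝓘(ℝ, ℝ × EuclideanSpace ℝ (Fin n))
      (fun u : EuclideanSpace ℝ (Fin n) => (t, u)) u :=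
    ((differentiableAt_const _).prodMk differentiableAt_id).mdifferentiableAt
  exact MDifferentiableAt.comp (f := fun u : EuclideanSpace ℝ (Fin n) => (t, u)) u joint slice

end ChartDomain

section Flow

variable {n k : ℕ}
  {M : Type*} [TopologicalSpace M] [ChartedSpace (EuclideanSpace ℝ (Fin n)) M]
  [IsManifold (𝓡 n) ∞ M]
  {N : Type*} [TopologicalSpace N] [ChartedSpace (EuclideanSpace ℝ (Fin k)) N]
  [IsManifold (𝓡 k) ∞ N]

/-- The harmonic Ricci flow with a coupling function of arbitrary sign; otherwise the same as
`IsHarmonicRicciFlow`. -/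
structure IsSignedHarmonicRicciFlow (J : Set ℝ) (g : ℝ → RMetric n M) (γ : RMetric k N)
    (φ : ℝ → M → N) (α : ℝ → ℝ) : Prop where
  metric_smooth : ∀ e ∈ charts n M, ∀ i j : Fin n,
    ContDiffOn ℝ ∞ (fun p : ℝ × EuclideanSpace ℝ (Fin n) => metricIn (g p.1) e p.2 i j)
      (J ×ˢ e.target)
  map_smooth : ContMDiffOn (𝓘(ℝ, ℝ).prod (𝓡 n)) (𝓡 k) ∞ (fun p : ℝ × M => φ p.1 p.2)
    (J ×ˢ Set.univ)
  coupling_differentiable : DifferentiableOn ℝ α J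
  metric_eq : ∀ t ∈ J, ∀ e ∈ charts n M, ∀ u ∈ e.target, ∀ i j : Fin n,
    deriv (fun s => metricIn (g s) e u i j) t =
      -2 * ricci (metricIn (g t) e) u i j + 2 * α t * pullbackIn γ (φ t) e u i j
  map_eq : ∀ t ∈ J, ∀ e ∈ charts n M, ∀ e' ∈ charts k N, ∀ x ∈ e.source,
    φ t x ∈ e'.source → ∀ a : Fin k,
      deriv (fun s => e' (φ s x) a) t = tensionIn (g t) γ (φ t) e e' x a

variable {J : Set ℝ} {g : ℝ → RMetric n M} {γ : RMetric k N} {φ : ℝ → M → N} {α : ℝ → ℝ}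
  {e : OpenPartialHomeomorph M (EuclideanSpace ℝ (Fin n))}

lemma IsHarmonicRicciFlow.isSigned (hflow : IsHarmonicRicciFlow J g γ φ α) :
    IsSignedHarmonicRicciFlow J g γ φ α :=
  ⟨hflow.metric_smooth, hflow.map_smooth, hflow.coupling_differentiable, hflow.metric_eq,
    hflow.map_eq⟩

namespace IsSignedHarmonicRicciFlow

variable (hflow : IsSignedHarmonicRicciFlow J g γ φ α) (he : e ∈ charts n M)
include hflow he

lemma isMetricFamily {Ω : Opens (ℝ × EuclideanSpace ℝ (Fin n))}
    (hΩ : (Ω : Set (ℝ × EuclideanSpace ℝ (Fin n))) ⊆ J ×ˢ e.target) :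
    IsMetricFamily Ω fun t => metricIn (g t) e where
  smooth i j := (hflow.metric_smooth e he i j).mono hΩ
  symm _ _ := metricIn_isSymm _ _ _
  det_ne_zero _ hq := (metricIn_posDef _ he (hΩ hq).2).det_pos.ne'

variable (hJ : IsOpen J) {t : ℝ} (ht : t ∈ J)
include hJ ht

lemma hasDerivAt_metricIn {u : EuclideanSpace ℝ (Fin n)} (hu : u ∈ e.target) (i j : Fin n) :
    HasDerivAt (fun s => metricIn (g s) e u i j)
      (((-2 : ℝ) • tensorSIn (g t) γ (φ t) (α t) e u) i j) t := by
  have hG := hflow.isMetricFamily he (Ω := chartDomain hJ e) subset_rfl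
  refine ((hG.rep_g i j).hasDerivAt ⟨(t, u), ht, hu⟩).differentiableAt.hasDerivAt.congr_deriv ?_
  rw [hflow.metric_eq t ht e he u hu i j]
  simp only [tensorSIn, Matrix.sub_apply, Matrix.smul_apply, smul_eq_mul]
  ring

variable {x : M} (hx : x ∈ e.source)
include hx

/-- Along the flow `S` is `-½ ∂ₜg`, so it transforms like the metric; no transformation law for the
Ricci tensor is needed. -/
lemma tensorSIn_change {e₂ : OpenPartialHomeomorph M (EuclideanSpace ℝ (Fin n))}
    (he₂ : e₂ ∈ charts n M) (hx₂ : x ∈ e₂.source) :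
    tensorSIn (g t) γ (φ t) (α t) e (e x) = (jacobian id e e₂ (e x)).transpose *
      tensorSIn (g t) γ (φ t) (α t) e₂ (e₂ x) * jacobian id e e₂ (e x) := by
  ext i j
  have in_first := hflow.hasDerivAt_metricIn he hJ ht (e.map_source hx) i j
  simp only [metricIn_change he he₂ hx hx₂ _] at in_first
  have in_second := hasDerivAt_mul_mul_apply
    (hflow.hasDerivAt_metricIn he₂ hJ ht (e₂.map_source hx₂))
    (jacobian id e e₂ (e x)).transpose (jacobian id e e₂ (e x)) i j
  have equal := in_first.unique in_second
  rw [Matrix.mul_smul, Matrix.smul_mul] at equal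
  exact mul_left_cancel₀ (by norm_num) equal

lemma traceS_eq : traceS (g t) γ (φ t) (α t) x =
    traceWith (metricIn (g t) e (e x)) (tensorSIn (g t) γ (φ t) (α t) e (e x)) := by
  have he₂ : chartAt (EuclideanSpace ℝ (Fin n)) x ∈ charts n M :=
    IsManifold.chart_mem_maximalAtlas x
  have hx₂ := mem_chart_source (EuclideanSpace ℝ (Fin n)) x
  rw [hflow.tensorSIn_change he hJ ht hx he₂ hx₂, traceWith_change he he₂ hx hx₂ (g t)]
  rfl

end IsSignedHarmonicRicciFlow

lemma gradSq_eq (h : RMetric n M) (hJ : IsOpen J) (he : e ∈ charts n M) {l : ℝ → M → ℝ}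
    (hl : ContMDiffOn (𝓘(ℝ, ℝ).prod (𝓡 n)) 𝓘(ℝ, ℝ) ∞ (fun p : ℝ × M => l p.1 p.2)
      (J ×ˢ Set.univ)) {t : ℝ} (ht : t ∈ J) {x : M} (hx : x ∈ e.source) :
    gradSq h (l t) x =
      gradPairing (metricIn h e) (l t ∘ e.symm) (l t ∘ e.symm) (e x) := by
  have he₂ : chartAt (EuclideanSpace ℝ (Fin n)) x ∈ charts n M :=
    IsManifold.chart_mem_maximalAtlas x
  have hx₂ := mem_chart_source (EuclideanSpace ℝ (Fin n)) x
  exact (gradPairing_change he he₂ hx hx₂ h (mdifferentiableAt_inChart he₂ hl hJ ht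
    ((chartAt _ x).map_source hx₂)).differentiableAt).symm

end Flow

/-! ### The heat kernel in coordinates -/

section Kernel

variable {n : ℕ} {Ω : Opens (ℝ × EuclideanSpace ℝ (Fin n))} {T : ℝ}

lemma kernelOf_ne_zero {M : Type*} (l : ℝ → M → ℝ) {t : ℝ} (ht : t < T) (x : M) :
    kernelOf n T l t x ≠ 0 := by
  have := sub_pos.2 ht
  unfold kernelOf
  positivity

lemma Rep.dx_eq_zero {f : SmoothFun Ω} {a : ℝ → ℝ} (hf : Rep f fun t _ => a t) (i : Fin n) :
    Dx i f = 0 :=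
  Subtype.ext <| funext fun p => (hf.dx i p).trans (by simp [pd])

variable {F : ℝ → EuclideanSpace ℝ (Fin n) → ℝ} (hT : ∀ q ∈ Ω, q.1 < T)

section Smooth

include hT

lemma kernelOf_contDiffOn
    (hF : ContDiffOn ℝ ∞ (fun q : ℝ × EuclideanSpace ℝ (Fin n) => F q.1 q.2) Ω) :
    ContDiffOn ℝ ∞ (fun q : ℝ × EuclideanSpace ℝ (Fin n) => kernelOf n T F q.1 q.2) Ω := by
  have time_smooth :
      ContDiff ℝ ∞ fun q : ℝ × EuclideanSpace ℝ (Fin n) => 4 * Real.pi * (T - q.1) :=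
    contDiff_const.mul (contDiff_const.sub contDiff_fst)
  refine (time_smooth.contDiffOn.rpow_const_of_ne fun q hq => ?_).mul hF.neg.exp
  have time_pos : 0 < T - q.1 := sub_pos.2 (hT q hq)
  positivity

lemma inv_two_mul_time_contDiffOn :
    ContDiffOn ℝ ∞ (fun q : ℝ × EuclideanSpace ℝ (Fin n) => 1 / (2 * (T - q.1))) Ω :=
  contDiffOn_const.div
    (contDiff_const.mul (contDiff_const.sub contDiff_fst)).contDiffOn
    fun q hq => mul_ne_zero two_ne_zero (sub_pos.2 (hT q hq)).ne'

end Smooth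

variable {L v σ c : SmoothFun Ω} (hL : Rep L F) (hv : Rep v (kernelOf n T F))
include hL hv

lemma Rep.dx_kernelOf (i : Fin n) : Dx i v = -(v * Dx i L) := by
  refine Subtype.ext (funext fun p => ?_)
  change (Dx i v).1 p = -(v.1 p * (Dx i L).1 p)
  rw [hv.dx i p, hL.dx i p, hv p]
  have slice : DifferentiableAt ℝ (F p.1.1) p.1.2 :=
    DifferentiableAt.comp (f := fun u : EuclideanSpace ℝ (Fin n) => (p.1.1, u)) p.1.2
      (hL.hasFDerivAt p).differentiableAt
      ((differentiableAt_const _).prodMk differentiableAt_id)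
  have kernel : HasFDerivAt (kernelOf n T F p.1.1) _ p.1.2 :=
    slice.hasFDerivAt.neg.exp.const_mul ((4 * Real.pi * (T - p.1.1)) ^ (-(n : ℝ) / 2))
  simp only [pd]
  rw [kernel.fderiv]
  simp only [kernelOf, smul_apply, neg_apply, Pi.neg_apply, smul_eq_mul]
  ring

include hT

lemma Rep.dt_kernelOf (hc : Rep c fun t _ => 1 / (2 * (T - t))) :
    Dt v = v * (n * c - Dt L) := by
  refine Subtype.ext (funext fun p => ?_)
  have time_pos : 0 < T - p.1.1 := sub_pos.2 (hT p.1 p.2)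
  have base_ne_zero : 4 * Real.pi * (T - p.1.1) ≠ 0 := by positivity
  have base : HasDerivAt (fun s => 4 * Real.pi * (T - s)) (4 * Real.pi * (0 - 1)) p.1.1 :=
    ((hasDerivAt_const _ _).sub (hasDerivAt_id _)).const_mul _
  have kernel : HasDerivAt (fun s => kernelOf n T F s p.1.2) _ p.1.1 :=
    (base.rpow_const (p := -(n : ℝ) / 2) (Or.inl base_ne_zero)).mul (hL.hasDerivAt p).neg.exp
  change (Dt v).1 p = v.1 p * (n * c.1 p - (Dt L).1 p)
  rw [(hv.hasDerivAt p).unique kernel, hv p, hc p, Real.rpow_sub_one base_ne_zero]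
  simp only [kernelOf, Pi.neg_apply]
  field_simp
  ring

lemma IsMetricFamily.isKernel {G : ℝ → EuclideanSpace ℝ (Fin n) → Matrix (Fin n) (Fin n) ℝ}
    (hG : IsMetricFamily Ω G) (hσ : Rep σ fun t _ => T - t)
    (hc : Rep c fun t _ => 1 / (2 * (T - t))) : hG.coordMetric.IsKernel Dt σ c L v where
  grad_time := funext hσ.dx_eq_zero
  d_time := Subtype.ext <| funext fun p =>
    (hσ.hasDerivAt p).unique ((hasDerivAt_id _).const_sub T)
  two_mul_time_mul := Subtype.ext <| funext fun p => by
    have time_pos : 0 < T - p.1.1 := sub_pos.2 (hT p.1 p.2)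
    change 2 * σ.1 p * c.1 p = 1
    rw [hσ p, hc p]
    field_simp
  isUnit := SmoothFun.isUnit_of_forall_ne_zero fun p =>
    (hv p).trans_ne (kernelOf_ne_zero F (hT p.1 p.2) p.1.2)
  grad_eq := funext (hL.dx_kernelOf hv)
  d_eq := by rw [Fintype.card_fin]; exact hL.dt_kernelOf hT hv hc

end Kernel

section Laplacian

variable {n k : ℕ}
  {M : Type*} [TopologicalSpace M] [ChartedSpace (EuclideanSpace ℝ (Fin n)) M]
  [IsManifold (𝓡 n) ∞ M]
  {N : Type*} [TopologicalSpace N] [ChartedSpace (EuclideanSpace ℝ (Fin k)) N]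
  [IsManifold (𝓡 k) ∞ N]
  {T : ℝ} {J : Set ℝ} {g : ℝ → RMetric n M} {γ : RMetric k N} {φ : ℝ → M → N} {α : ℝ → ℝ}
  {l : ℝ → M → ℝ} {e : OpenPartialHomeomorph M (EuclideanSpace ℝ (Fin n))}

namespace IsSignedHarmonicRicciFlow

variable (hflow : IsSignedHarmonicRicciFlow J g γ φ α) (hJ : IsOpen J) (hJT : J ⊆ Set.Iio T)
  (hl : ContMDiffOn (𝓘(ℝ, ℝ).prod (𝓡 n)) 𝓘(ℝ, ℝ) ∞ (fun p : ℝ × M => l p.1 p.2)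
    (J ×ˢ Set.univ)) {t : ℝ} (ht : t ∈ J) {x : M}
include hflow hJ hJT hl ht

lemma laplacianIn_kernelOf (he : e ∈ charts n M) (hx : x ∈ e.source) :
    laplacianIn (g t) e (kernelOf n T l t) x =
      kernelOf n T l t x * (gradSq (g t) (l t) x - laplacianIn (g t) e (l t) x) := by
  have hG := hflow.isMetricFamily he (Ω := chartDomain hJ e) subset_rfl
  have l_smooth : ContDiffOn ℝ ∞ (fun q : ℝ × EuclideanSpace ℝ (Fin n) =>
      (fun t u => l t (e.symm u)) q.1 q.2) (chartDomain hJ e) :=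
    (contMDiffOn_inChart he hl).contDiffOn
  have hL := rep_mk (Ω := chartDomain hJ e) (F := fun t u => l t (e.symm u)) l_smooth
  have hv := rep_mk (Ω := chartDomain hJ e) (F := kernelOf n T fun t u => l t (e.symm u))
    (kernelOf_contDiffOn (fun q hq => hJT hq.1) l_smooth)
  have ring_identity :=
    CoordMetric.lap_eq_of_grad_eq (X := hG.coordMetric) (funext (hL.dx_kernelOf hv))
  have at_point := hv.mul ((hG.rep_pair hL hL).sub (hG.rep_lap hL)) ⟨(t, e x), ht, e.map_source hx⟩
  rw [← ring_identity, hG.rep_lap hv] at at_point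
  simp only [kernelOf, e.left_inv hx] at at_point
  rw [gradSq_eq (g t) hJ he hl ht hx]
  exact at_point

/-- The equation for `v`, read in two charts, determines `Δv` and hence `Δl`, since `∂ₜv`, `tr S`
and `|∇l|²` are the same in both; no transformation law for the Hessian is needed. -/
lemma laplacian_eq
    (hv : ∀ t ∈ J, ∀ e ∈ charts n M, ∀ x ∈ e.source,
      adjointHeatIn g γ φ α e (kernelOf n T l) t x = 0)
    (he : e ∈ charts n M) (hx : x ∈ e.source) :
    laplacian (g t) (l t) x = laplacianIn (g t) e (l t) x := by
  have he₂ : chartAt (EuclideanSpace ℝ (Fin n)) x ∈ charts n M :=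
    IsManifold.chart_mem_maximalAtlas x
  have hx₂ := mem_chart_source (EuclideanSpace ℝ (Fin n)) x
  have in_given := hv t ht e he x hx
  have in_preferred := hv t ht _ he₂ x hx₂
  rw [adjointHeatIn, hflow.laplacianIn_kernelOf hJ hJT hl ht he hx] at in_given
  rw [adjointHeatIn, hflow.laplacianIn_kernelOf hJ hJT hl ht he₂ hx₂] at in_preferred
  refine mul_left_cancel₀ (kernelOf_ne_zero (n := n) l (hJT ht) x) ?_
  unfold laplacian
  linear_combination in_preferred - in_given

end IsSignedHarmonicRicciFlow

end Laplacian

/-! ### Families of maps in coordinates -/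

section TargetMetric

variable {k : ℕ} {N : Type*} [TopologicalSpace N] [ChartedSpace (EuclideanSpace ℝ (Fin k)) N]
  [IsManifold (𝓡 k) ∞ N] (γ : RMetric k N)
  {e : OpenPartialHomeomorph N (EuclideanSpace ℝ (Fin k))} (he : e ∈ charts k N)
include he

lemma isMetricFamily_const :
    IsMetricFamily (chartDomain isOpen_univ e) fun _ => metricIn γ e where
  smooth a b := (metricIn_contDiffOn γ he a b).comp contDiff_snd.contDiffOn fun _ hq => hq.2
  symm _ _ := metricIn_isSymm _ _ _
  det_ne_zero _ hq := (metricIn_posDef _ he hq.2).det_pos.ne'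

lemma christoffel_contDiffOn (a b c : Fin k) :
    ContDiffOn ℝ ∞ (christoffel (metricIn γ e) a b c) e.target := by
  have hG := isMetricFamily_const γ he
  refine ((SmoothFun.contDiffOn_extension (hG.coordMetric.Γ b a c)).comp
    (contDiff_prodMk_right (0 : ℝ)).contDiffOn fun u hu => ⟨trivial, hu⟩).congr fun u hu => ?_
  have point := hG.rep_Γ b c a ⟨(0, u), trivial, hu⟩
  rw [← SmoothFun.extension_apply] at point
  exact point.symm

variable {y : EuclideanSpace ℝ (Fin k)} (hy : y ∈ e.target)
include hy

lemma christoffel_symm (a b c : Fin k) :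
    christoffel (metricIn γ e) a b c y = christoffel (metricIn γ e) a c b y := by
  have hG := isMetricFamily_const γ he
  have point := hG.rep_Γ b c a ⟨(0, y), trivial, hy⟩
  rw [hG.coordMetric.Γ_symm, hG.rep_Γ] at point
  exact point.symm

lemma pd_metricIn (c a b : Fin k) : pd c (fun z => metricIn γ e z a b) y =
    ∑ d, christoffel (metricIn γ e) d c a y * metricIn γ e y d b
      + ∑ d, metricIn γ e y a d * christoffel (metricIn γ e) d c b y := by
  have hG := isMetricFamily_const γ he
  let p : chartDomain isOpen_univ e := ⟨(0, y), trivial, hy⟩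
  have derivative := (hG.rep_g a b).dx c p
  have connection : Rep (∑ d, hG.coordMetric.Γ c d a * hG.coordMetric.g d b
      + ∑ d, hG.coordMetric.g a d * hG.coordMetric.Γ c d b) _ :=
    (Rep.sum fun d => (hG.rep_Γ c a d).mul (hG.rep_g d b)).add
      (Rep.sum fun d => (hG.rep_g a d).mul (hG.rep_Γ c b d))
  have parallel := congrFun (congrFun (hG.coordMetric.map_D_g c) a) b
  exact derivative.symm.trans
    ((congrArg (SmoothFun.ev p) parallel).trans (connection _))

end TargetMetric

section MapFamilies

variable {n k : ℕ} {M : Type*} [TopologicalSpace M]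
  {N : Type*} [TopologicalSpace N] [ChartedSpace (EuclideanSpace ℝ (Fin k)) N]
  {Ω : Opens (ℝ × EuclideanSpace ℝ (Fin n))} {φ : ℝ → M → N}
  {e : OpenPartialHomeomorph M (EuclideanSpace ℝ (Fin n))}
  {e' : OpenPartialHomeomorph N (EuclideanSpace ℝ (Fin k))}

/-- A smooth family of maps into `N`, read in the charts `e` and `e'` on the open set `Ω` of
space-time. -/
structure IsMapFamily (Ω : Opens (ℝ × EuclideanSpace ℝ (Fin n))) (φ : ℝ → M → N)
    (e : OpenPartialHomeomorph M (EuclideanSpace ℝ (Fin n)))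
    (e' : OpenPartialHomeomorph N (EuclideanSpace ℝ (Fin k))) : Prop where
  mem_charts : e' ∈ charts k N
  smooth : ContDiffOn ℝ ∞ (fun q : ℝ × EuclideanSpace ℝ (Fin n) => e' (φ q.1 (e.symm q.2))) Ω
  mem_source : ∀ q ∈ Ω, φ q.1 (e.symm q.2) ∈ e'.source

namespace IsMapFamily

variable [IsManifold (𝓡 k) ∞ N] (hφ : IsMapFamily Ω φ e e') (γ : RMetric k N)

/-- The family as a map over the ring of smooth functions on `Ω`. -/
def coordMap : CoordMap (Fin k) (SmoothFun Ω) where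
  φ a := SmoothFun.mk (fun q => mapComp (φ q.1) e e' a q.2)
    ((EuclideanSpace.proj a : EuclideanSpace ℝ (Fin k) →L[ℝ] ℝ).contDiff.comp_contDiffOn hφ.smooth)
  H := Matrix.of fun a b => SmoothFun.mk (fun q => metricIn γ e' (e' (φ q.1 (e.symm q.2))) a b)
    ((metricIn_contDiffOn γ hφ.mem_charts a b).comp hφ.smooth
      fun q hq => e'.map_source (hφ.mem_source q hq))
  ΓN a b c := SmoothFun.mk (fun q => christoffel (metricIn γ e') a b c (e' (φ q.1 (e.symm q.2))))
    ((christoffel_contDiffOn γ hφ.mem_charts a b c).comp hφ.smooth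
      fun q hq => e'.map_source (hφ.mem_source q hq))
  H_symm := Matrix.IsSymm.ext fun a b =>
    Subtype.ext (funext fun _ => (metricIn_isSymm γ e' _).apply a b)
  ΓN_symm a b c := Subtype.ext (funext fun p => christoffel_symm γ hφ.mem_charts
    (e'.map_source (hφ.mem_source p.1 p.2)) a b c)

lemma isCompat (w : ℝ × EuclideanSpace ℝ (Fin n)) :
    (hφ.coordMap γ).IsCompat (SmoothFun.D w) := by
  refine Matrix.ext fun a b => Subtype.ext (funext fun p => ?_)
  set Φ := fun q : ℝ × EuclideanSpace ℝ (Fin n) => e' (φ q.1 (e.symm q.2))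
  have in_target : Φ p ∈ e'.target := e'.map_source (hφ.mem_source p.1 p.2)
  have metric_differentiable : DifferentiableAt ℝ (fun z => metricIn γ e' z a b) (Φ p) :=
    ((metricIn_contDiffOn γ hφ.mem_charts a b).contDiffAt
      (e'.open_target.mem_nhds in_target)).differentiableAt (by simp)
  have map_differentiable : DifferentiableAt ℝ Φ p :=
    (hφ.smooth.contDiffAt (Ω.isOpen.mem_nhds p.2)).differentiableAt (by simp)
  have component (c : Fin k) : SmoothFun.ev p (SmoothFun.D w ((hφ.coordMap γ).φ c)) =
      fderiv ℝ (fun q => Φ q c) p w := SmoothFun.D_apply (fun _ => rfl) p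
  have metric_value (c d : Fin k) :
      SmoothFun.ev p ((hφ.coordMap γ).H c d) = metricIn γ e' (Φ p) c d := rfl
  have christoffel_value (c d f : Fin k) :
      SmoothFun.ev p ((hφ.coordMap γ).ΓN c d f) = christoffel (metricIn γ e') c d f (Φ p) := rfl
  have chain_rule : (SmoothFun.D w ((hφ.coordMap γ).H a b)).1 p =
      ∑ c, fderiv ℝ (fun q => Φ q c) p w * pd c (fun z => metricIn γ e' z a b) (Φ p) :=
    (SmoothFun.D_apply (fun _ => rfl) p).trans
      (fderiv_comp_eq_sum_pd metric_differentiable map_differentiable w)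
  refine chain_rule.trans ?_
  rw [← SmoothFun.ev_apply]
  simp only [Matrix.add_apply, Matrix.mul_apply, Matrix.transpose_apply, CoordMap.conn,
    Matrix.of_apply, CoordMap.deriv, map_add, map_sum, map_mul, component,
    metric_value, christoffel_value,
    pd_metricIn γ hφ.mem_charts in_target, mul_add, Finset.mul_sum, Finset.sum_mul,
    Finset.sum_add_distrib]
  refine congrArg₂ (· + ·) ?_ ?_ <;> rw [Finset.sum_comm] <;>
    exact Finset.sum_congr rfl fun d _ => Finset.sum_congr rfl fun c _ => by ring

lemma rep_φ (a : Fin k) : Rep ((hφ.coordMap γ).φ a) fun t u => mapComp (φ t) e e' a u :=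
  fun _ => rfl

lemma rep_H (a b : Fin k) :
    Rep ((hφ.coordMap γ).H a b) fun t u => metricIn γ e' (e' (φ t (e.symm u))) a b :=
  fun _ => rfl

lemma rep_ip {V : Fin k → SmoothFun Ω} {V' : Fin k → ℝ → EuclideanSpace ℝ (Fin n) → ℝ}
    (hV : ∀ a, Rep (V a) (V' a)) : Rep ((hφ.coordMap γ).ip V V) fun t u =>
      ∑ a, ∑ b, metricIn γ e' (e' (φ t (e.symm u))) a b * V' a t u * V' b t u := by
  have nested : Rep ((hφ.coordMap γ).ip V V) fun t u =>
      ∑ a, V' a t u * ∑ b, metricIn γ e' (e' (φ t (e.symm u))) a b * V' b t u :=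
    Rep.sum fun a => (hV a).mul (Rep.sum fun b => (hφ.rep_H γ a b).mul (hV b))
  refine nested.congr fun q _ => ?_
  simp only [Finset.mul_sum, mul_left_comm, mul_assoc]

variable [ChartedSpace (EuclideanSpace ℝ (Fin n)) M] [IsManifold (𝓡 n) ∞ M] {g : ℝ → RMetric n M}
  (hG : IsMetricFamily Ω fun t => metricIn (g t) e)

lemma rep_pb (hd : ∀ q ∈ Ω, MDifferentiableAt (𝓡 n) (𝓡 k) (φ q.1 ∘ e.symm) q.2) (i j : Fin n) :
    Rep (hG.coordMetric.pb (hφ.coordMap γ) i j) fun t u => pullbackIn γ (φ t) e u i j := by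
  have in_coordinates : Rep (hG.coordMetric.pb (hφ.coordMap γ) i j) fun t u =>
      ∑ a, jacobian (φ t) e e' u a i *
        ∑ b, metricIn γ e' (e' (φ t (e.symm u))) a b * jacobian (φ t) e e' u b j :=
    Rep.sum fun a => ((hφ.rep_φ γ a).dx i).mul
      (Rep.sum fun b => (hφ.rep_H γ a b).mul ((hφ.rep_φ γ b).dx j))
  refine in_coordinates.congr fun q hq => ?_
  rw [pullbackIn_eq γ hφ.mem_charts (hd q hq) (hφ.mem_source q hq), Matrix.mul_assoc]
  rfl

lemma rep_tens (hΩ : ∀ q ∈ Ω, q.2 ∈ e.target) (a : Fin k) :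
    Rep (hG.coordMetric.tens (hφ.coordMap γ) a) fun t u =>
      tensionIn (g t) γ (φ t) e e' (e.symm u) a := by
  have in_coordinates : Rep (hG.coordMetric.tens (hφ.coordMap γ) a) fun t u =>
      traceWith (metricIn (g t) e u) (hessian (metricIn (g t) e) (mapComp (φ t) e e' a) u)
      + ∑ b, ∑ c, christoffel (metricIn γ e') a b c (e' (φ t (e.symm u))) *
        gradPairing (metricIn (g t) e) (mapComp (φ t) e e' b) (mapComp (φ t) e e' c) u := by
    rw [CoordMetric.tens_apply]
    exact (hG.rep_lap (hφ.rep_φ γ a)).add (Rep.sum fun b => Rep.sum fun c =>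
      Rep.mul (fun _ => rfl) (hG.rep_pair (hφ.rep_φ γ b) (hφ.rep_φ γ c)))
  refine in_coordinates.congr fun q hq => ?_
  simp only [tensionIn, e.right_inv (hΩ q hq)]

lemma rep_tensS (hd : ∀ q ∈ Ω, MDifferentiableAt (𝓡 n) (𝓡 k) (φ q.1 ∘ e.symm) q.2)
    {β : SmoothFun Ω} {b : ℝ → ℝ} (hβ : Rep β fun t _ => b t) (i j : Fin n) :
    Rep (hG.coordMetric.tensS (hφ.coordMap γ) β i j) fun t u =>
      tensorSIn (g t) γ (φ t) (b t) e u i j :=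
  (hG.rep_ric i j).sub (hβ.mul (hφ.rep_pb γ hG hd i j))

end IsMapFamily

end MapFamilies

/-! ### The Harnack quantity in coordinates -/

section Harnack

variable {n k : ℕ}
  {M : Type*} [TopologicalSpace M] [ChartedSpace (EuclideanSpace ℝ (Fin n)) M]
  [IsManifold (𝓡 n) ∞ M]
  {N : Type*} [TopologicalSpace N] [ChartedSpace (EuclideanSpace ℝ (Fin k)) N]
  [IsManifold (𝓡 k) ∞ N]

/-- The function `w` of `harnackOf`, computed in the chart `e` instead of the preferred charts. -/
def harnackIn (T : ℝ) (g : ℝ → RMetric n M) (γ : RMetric k N) (φ : ℝ → M → N) (α : ℝ → ℝ)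
    (l : ℝ → M → ℝ) (e : OpenPartialHomeomorph M (EuclideanSpace ℝ (Fin n))) (t : ℝ) (x : M) : ℝ :=
  ((T - t) * (2 * laplacianIn (g t) e (l t) x
      - gradPairing (metricIn (g t) e) (l t ∘ e.symm) (l t ∘ e.symm) (e x)
      + traceWith (metricIn (g t) e (e x)) (tensorSIn (g t) γ (φ t) (α t) e (e x)))
    + l t x - n) * kernelOf n T l t x

lemma harnackIn_sub (T : ℝ) (g : ℝ → RMetric n M) (γ : RMetric k N) (φ : ℝ → M → N) (α β : ℝ → ℝ)
    (l : ℝ → M → ℝ) (e : OpenPartialHomeomorph M (EuclideanSpace ℝ (Fin n))) (t : ℝ) (x : M) :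
    harnackIn T g γ φ α l e t x = harnackIn T g γ φ β l e t x
      - (α t - β t) * ((T - t) * energyIn (g t) γ (φ t) e x * kernelOf n T l t x) := by
  have trace (a : ℝ) : traceWith (metricIn (g t) e (e x)) (tensorSIn (g t) γ (φ t) a e (e x)) =
      traceWith (metricIn (g t) e (e x)) (ricci (metricIn (g t) e) (e x))
        - a * energyIn (g t) γ (φ t) e x := by
    simp only [energyIn, tensorSIn, traceWith_eq_trace, Matrix.transpose_sub,
      Matrix.transpose_smul, Matrix.mul_sub, Matrix.mul_smul, Matrix.trace_sub, Matrix.trace_smul,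
      smul_eq_mul]
  rw [harnackIn, harnackIn, trace, trace]
  ring

variable {Ω : Opens (ℝ × EuclideanSpace ℝ (Fin n))}
  {g : ℝ → RMetric n M} {φ : ℝ → M → N} {b : ℝ → ℝ} {l : ℝ → M → ℝ} {T : ℝ}
  {e : OpenPartialHomeomorph M (EuclideanSpace ℝ (Fin n))}
  {e' : OpenPartialHomeomorph N (EuclideanSpace ℝ (Fin k))} {β σ c L v f : SmoothFun Ω}

namespace IsMapFamily

variable (hφ : IsMapFamily Ω φ e e') (γ : RMetric k N)
  (hG : IsMetricFamily Ω fun t => metricIn (g t) e) (hΩ : ∀ q ∈ Ω, q.2 ∈ e.target)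
include hΩ

lemma rep_solitonMapSq (hL : Rep L fun t u => l t (e.symm u)) :
    Rep ((hφ.coordMap γ).ip
        (hG.coordMetric.tens (hφ.coordMap γ)
          - hG.coordMetric.pushed (hφ.coordMap γ) (hG.coordMetric.grad L))
        (hG.coordMetric.tens (hφ.coordMap γ)
          - hG.coordMetric.pushed (hφ.coordMap γ) (hG.coordMetric.grad L)))
      fun t u => solitonMapSq (g t) γ (φ t) (l t) e e' (e.symm u) := by
  refine (hφ.rep_ip γ fun a => (hφ.rep_tens γ hG hΩ a).sub
    (hG.rep_pair (hφ.rep_φ γ a) hL)).congr fun q hq => ?_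
  rw [solitonMapSq, e.right_inv (hΩ q hq)]
  rfl

variable (hd : ∀ q ∈ Ω, MDifferentiableAt (𝓡 n) (𝓡 k) (φ q.1 ∘ e.symm) q.2)
include hd

lemma rep_energy : Rep (hG.coordMetric.tr (hG.coordMetric.pb (hφ.coordMap γ)))
    fun t u => energyIn (g t) γ (φ t) e (e.symm u) := by
  refine (hG.rep_tr (hφ.rep_pb γ hG hd)).congr fun q hq => ?_
  rw [energyIn, e.right_inv (hΩ q hq)]

variable (hβ : Rep β fun t _ => b t)
include hβ

lemma rep_solitonTensorSq (hL : Rep L fun t u => l t (e.symm u))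
    (hc : Rep c fun t _ => 1 / (2 * (T - t))) :
    Rep (hG.coordMetric.pair2
        (hG.coordMetric.tensS (hφ.coordMap γ) β + hG.coordMetric.hess L
          - c • fun i j => hG.coordMetric.g i j)
        (hG.coordMetric.tensS (hφ.coordMap γ) β + hG.coordMetric.hess L
          - c • fun i j => hG.coordMetric.g i j))
      fun t u => solitonTensorSq (g t) γ (φ t) (b t) (l t) (T - t) e (e.symm u) := by
  have in_coordinates := hG.rep_pair2
    (S' := fun t u => tensorSIn (g t) γ (φ t) (b t) e u
      + hessian (metricIn (g t) e) (l t ∘ e.symm) u - (1 / (2 * (T - t))) • metricIn (g t) e u)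
    fun i j => ((hφ.rep_tensS γ hG hd hβ i j).add (hG.rep_hess hL i j)).sub
      (hc.mul (hG.rep_g i j))
  refine in_coordinates.congr fun q hq => ?_
  rw [solitonTensorSq, e.right_inv (hΩ q hq)]

lemma rep_harnack (hL : Rep L fun t u => l t (e.symm u)) (hσ : Rep σ fun t _ => T - t)
    (hv : Rep v fun t u => kernelOf n T l t (e.symm u)) :
    Rep (hG.coordMetric.harnack (hφ.coordMap γ) β σ L v)
      fun t u => harnackIn T g γ φ b l e t (e.symm u) := by
  have two : Rep (2 : SmoothFun Ω) fun _ _ => 2 := fun _ => rfl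
  have dimension : Rep ((Fintype.card (Fin n) : ℕ) : SmoothFun Ω) fun _ _ => n := fun p =>
    (map_natCast (SmoothFun.ev p) _).trans (by rw [Fintype.card_fin])
  have density := ((two.mul (hG.rep_lap hL)).sub (hG.rep_pair hL hL)).add
    (hG.rep_tr (hφ.rep_tensS γ hG hd hβ))
  refine Rep.congr ((((hσ.mul density).add hL).sub dimension).mul hv) fun q hq => ?_
  rw [harnackIn, laplacianIn, e.right_inv (hΩ q hq)]
  rfl

lemma rep_adjointHeat {F : ℝ → M → ℝ} (hf : Rep f fun t u => F t (e.symm u)) :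
    Rep (hG.coordMetric.adjointHeat (hφ.coordMap γ) β Dt f) fun t u =>
      -deriv (fun s => F s (e.symm u)) t - laplacianIn (g t) e (F t) (e.symm u)
        + traceWith (metricIn (g t) e u) (tensorSIn (g t) γ (φ t) (b t) e u)
          * F t (e.symm u) := by
  refine Rep.congr ((hf.dt.neg.sub (hG.rep_lap hf)).add
    ((hG.rep_tr (hφ.rep_tensS γ hG hd hβ)).mul hf)) fun q hq => ?_
  rw [laplacianIn, e.right_inv (hΩ q hq)]
  rfl

end IsMapFamily

end Harnack

/-! ### The flow on a time slice -/

section Slice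

variable {n : ℕ} {Ω : Opens (ℝ × EuclideanSpace ℝ (Fin n))}

/-- Restriction of smooth functions to the time slice at `t₀`. -/
def slice (Ω : Opens (ℝ × EuclideanSpace ℝ (Fin n))) (t₀ : ℝ) :
    SmoothFun Ω →+* ({u : EuclideanSpace ℝ (Fin n) // (t₀, u) ∈ Ω} → ℝ) :=
  RingHom.pi fun u => SmoothFun.ev ⟨(t₀, u.1), u.2⟩

lemma slice_apply (t₀ : ℝ) (f : SmoothFun Ω) (u : {u // (t₀, u) ∈ Ω}) :
    slice Ω t₀ f u = f.1 ⟨(t₀, u.1), u.2⟩ := rfl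

lemma slice_dx_congr {t₀ : ℝ} {f h : SmoothFun Ω} (hfh : slice Ω t₀ f = slice Ω t₀ h)
    (i : Fin n) : slice Ω t₀ (Dx i f) = slice Ω t₀ (Dx i h) := by
  have rep_extension (f : SmoothFun Ω) : Rep f fun t u => SmoothFun.extension f (t, u) :=
    fun p => (SmoothFun.extension_apply f p).symm
  funext u
  have slice_open : IsOpen {z | (t₀, z) ∈ Ω} := Ω.isOpen.preimage (.prodMk_right t₀)
  have near : (fun z => SmoothFun.extension f (t₀, z)) =ᶠ[nhds u.1]
      fun z => SmoothFun.extension h (t₀, z) := by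
    filter_upwards [slice_open.mem_nhds u.2] with z hz
    exact (rep_extension f ⟨_, hz⟩).symm.trans
      ((congrFun hfh ⟨z, hz⟩).trans (rep_extension h ⟨_, hz⟩))
  rw [slice_apply, slice_apply, (rep_extension f).dx i, (rep_extension h).dx i]
  exact congrArg (· (EuclideanSpace.single i 1)) (near.fderiv_eq (𝕜 := ℝ))

end Slice

section Taylor

/-- The first order Taylor polynomial of the coupling function at `t₀`. It replaces the coupling
function, which is only differentiable, in the ring of smooth functions. -/
def taylor (α : ℝ → ℝ) (t₀ t : ℝ) : ℝ := α t₀ + deriv α t₀ * (t - t₀)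

lemma taylor_self (α : ℝ → ℝ) (t₀ : ℝ) : taylor α t₀ t₀ = α t₀ := by
  rw [taylor, sub_self, mul_zero, add_zero]

lemma hasDerivAt_taylor (α : ℝ → ℝ) (t₀ t : ℝ) : HasDerivAt (taylor α t₀) (deriv α t₀) t :=
  ((((hasDerivAt_id t).sub_const t₀).const_mul (deriv α t₀)).const_add (α t₀)).congr_deriv
    (mul_one _)

lemma contDiff_taylor (α : ℝ → ℝ) (t₀ : ℝ) : ContDiff ℝ ∞ (taylor α t₀) := by
  unfold taylor
  fun_prop

end Taylor

section Congr

variable {n : ℕ} {M : Type*} [TopologicalSpace M] [ChartedSpace (EuclideanSpace ℝ (Fin n)) M]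
  [IsManifold (𝓡 n) ∞ M]

lemma hessian_congr (G : EuclideanSpace ℝ (Fin n) → Matrix (Fin n) (Fin n) ℝ)
    {f h : EuclideanSpace ℝ (Fin n) → ℝ} {u : EuclideanSpace ℝ (Fin n)}
    (hfh : f =ᶠ[nhds u] h) : hessian G f u = hessian G h u := by
  have partials (j : Fin n) : pd j f =ᶠ[nhds u] pd j h := by
    filter_upwards [hfh.fderiv (𝕜 := ℝ)] with z hz
    rw [pd, hz, pd]
  ext i j
  have second : pd i (pd j f) u = pd i (pd j h) u := by rw [pd, (partials j).fderiv_eq, pd]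
  simp only [hessian, Matrix.of_apply, second, (partials _).eq_of_nhds]

lemma laplacianIn_congr (g : RMetric n M)
    {e : OpenPartialHomeomorph M (EuclideanSpace ℝ (Fin n))} {f h : M → ℝ}
    (hfh : Set.EqOn f h e.source) {x : M} (hx : x ∈ e.source) :
    laplacianIn g e f x = laplacianIn g e h x := by
  rw [laplacianIn, laplacianIn, hessian_congr]
  filter_upwards [e.open_target.mem_nhds (e.map_source hx)] with u hu
  exact hfh (e.map_target hu)

end Congr

section Flow

variable {n k : ℕ}
  {M : Type*} [TopologicalSpace M] [ChartedSpace (EuclideanSpace ℝ (Fin n)) M]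
  [IsManifold (𝓡 n) ∞ M]
  {N : Type*} [TopologicalSpace N] [ChartedSpace (EuclideanSpace ℝ (Fin k)) N]
  [IsManifold (𝓡 k) ∞ N]
  {T : ℝ} {J : Set ℝ} {g : ℝ → RMetric n M} {γ : RMetric k N} {φ : ℝ → M → N} {α : ℝ → ℝ}
  {l : ℝ → M → ℝ} {e : OpenPartialHomeomorph M (EuclideanSpace ℝ (Fin n))}
  {e' : OpenPartialHomeomorph N (EuclideanSpace ℝ (Fin k))}

namespace IsSignedHarmonicRicciFlow

variable (hflow : IsSignedHarmonicRicciFlow J g γ φ α) (hJ : IsOpen J) (he : e ∈ charts n M)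

/-- The times and the coordinates in the chart `e` at which the flow maps into the chart `e'`. -/
def domain (e' : OpenPartialHomeomorph N (EuclideanSpace ℝ (Fin k))) :
    Opens (ℝ × EuclideanSpace ℝ (Fin n)) where
  carrier := (J ×ˢ e.target) ∩ (fun q => φ q.1 (e.symm q.2)) ⁻¹' e'.source
  is_open' := (contMDiffOn_inChart he hflow.map_smooth).continuousOn.isOpen_inter_preimage
    (hJ.prod e.open_target) e'.open_source

lemma isMapFamily_domain (he' : e' ∈ charts k N) :
    IsMapFamily (hflow.domain hJ he e') φ e e' where
  mem_charts := he'
  smooth := contMDiffOn_iff_contDiffOn.1 ((contMDiffOn_of_mem_maximalAtlas he').comp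
    ((contMDiffOn_inChart he hflow.map_smooth).mono Set.inter_subset_left) fun _ hq => hq.2)
  mem_source _ hq := hq.2

variable {Ω : Opens (ℝ × EuclideanSpace ℝ (Fin n))}
  (hΩ : (Ω : Set (ℝ × EuclideanSpace ℝ (Fin n))) ⊆ J ×ˢ e.target)

include hflow hJ he hΩ in
lemma mdifferentiableAt_map {q : ℝ × EuclideanSpace ℝ (Fin n)} (hq : q ∈ Ω) :
    MDifferentiableAt (𝓡 n) (𝓡 k) (φ q.1 ∘ e.symm) q.2 :=
  mdifferentiableAt_inChart he hflow.map_smooth hJ (hΩ hq).1 (hΩ hq).2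

variable (hφ : IsMapFamily Ω φ e e') {t₀ : ℝ} (ht₀ : t₀ ∈ J) {β : SmoothFun Ω}
  (hβ : Rep β fun t _ => taylor α t₀ t)

include hJ hβ ht₀ in
lemma isFlow : CoordMetric.IsFlow (hflow.isMetricFamily he hΩ).coordMetric (hφ.coordMap γ) β Dt
    (slice Ω t₀) where
  congr i _ _ h := slice_dx_congr h i
  compat _ := hφ.isCompat γ _
  compat_d := hφ.isCompat γ _
  comm _ _ := SmoothFun.D_comm _ _ _
  grad_coupling := funext hβ.dx_eq_zero
  metric_eq i j := funext fun u => by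
    let p : Ω := ⟨(t₀, u.1), u.2⟩
    have tensor : _ = tensorSIn (g t₀) γ (φ t₀) (α t₀) e u.1 i j :=
      (hφ.rep_tensS γ (hflow.isMetricFamily he hΩ)
        (fun q => hflow.mdifferentiableAt_map hJ he hΩ) hβ i j p).trans
          (congrArg (fun a => tensorSIn (g t₀) γ (φ t₀) a e u.1 i j) (taylor_self α t₀))
    exact (((hflow.isMetricFamily he hΩ).rep_g i j).hasDerivAt p).unique
      ((hflow.hasDerivAt_metricIn he hJ ht₀ (hΩ u.2).2 i j).congr_deriv
        (congrArg ((-2 : ℝ) * ·) tensor.symm))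
  map_eq a := funext fun u => by
    let p : Ω := ⟨(t₀, u.1), u.2⟩
    exact ((hφ.rep_φ γ a).dt p).trans ((hflow.map_eq t₀ ht₀ e he e' hφ.mem_charts (e.symm u.1)
      (e.map_target (hΩ u.2).2) (hφ.mem_source p p.2) a).trans
        (hφ.rep_tens γ (hflow.isMetricFamily he hΩ) (fun q hq => (hΩ hq).2) a p).symm)

include hJ ht₀ hβ in
lemma adjointHeat_apply {f : SmoothFun Ω} {F : ℝ → M → ℝ} (hf : Rep f fun t u => F t (e.symm u))
    {u : EuclideanSpace ℝ (Fin n)} (hu : (t₀, u) ∈ Ω) :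
    slice Ω t₀ ((hflow.isMetricFamily he hΩ).coordMetric.adjointHeat (hφ.coordMap γ) β Dt f)
      ⟨u, hu⟩ = adjointHeatIn g γ φ α e F t₀ (e.symm u) := by
  rw [adjointHeatIn, hflow.traceS_eq he hJ ht₀ (e.map_target (hΩ hu).2), e.right_inv (hΩ hu).2,
    ← taylor_self α t₀]
  exact hφ.rep_adjointHeat γ (hflow.isMetricFamily he hΩ) (fun q hq => (hΩ hq).2)
    (fun q => hflow.mdifferentiableAt_map hJ he hΩ) hβ hf ⟨(t₀, u), hu⟩

section Harnack

variable (hJT : J ⊆ Set.Iio T)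
  (hl : ContMDiffOn (𝓘(ℝ, ℝ).prod (𝓡 n)) 𝓘(ℝ, ℝ) ∞ (fun p : ℝ × M => l p.1 p.2)
    (J ×ˢ Set.univ))
  (hv : ∀ t ∈ J, ∀ e ∈ charts n M, ∀ x ∈ e.source,
    adjointHeatIn g γ φ α e (kernelOf n T l) t x = 0)
  {t : ℝ} (ht : t ∈ J) {x : M} (hx : x ∈ e.source)
include hflow hJ he hJT hl hv ht hx

lemma harnackOf_eq : harnackOf T g γ φ α l t x = harnackIn T g γ φ α l e t x := by
  rw [harnackOf, hflow.laplacian_eq hJ hJT hl ht hv he hx, gradSq_eq (g t) hJ he hl ht hx,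
    hflow.traceS_eq he hJ ht hx, harnackIn]

/-- The error of the Taylor polynomial vanishes to first order at `t`. -/
lemma deriv_harnackOf_eq
    (hw : DifferentiableAt ℝ (fun s => harnackIn T g γ φ (taylor α t) l e s x) t)
    (hE : DifferentiableAt ℝ
      (fun s => (T - s) * energyIn (g s) γ (φ s) e x * kernelOf n T l s x) t) :
    deriv (fun s => harnackOf T g γ φ α l s x) t =
      deriv (fun s => harnackIn T g γ φ (taylor α t) l e s x) t := by
  have error : HasDerivAt (fun s => α s - taylor α t s) 0 t :=
    (((hflow.coupling_differentiable t ht).differentiableAt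
      (hJ.mem_nhds ht)).hasDerivAt.sub (hasDerivAt_taylor α t t)).congr_deriv (sub_self _)
  have expansion := hw.hasDerivAt.sub (error.mul hE.hasDerivAt)
  rw [taylor_self, sub_self, zero_mul, zero_mul, add_zero, sub_zero] at expansion
  refine (expansion.congr_of_eventuallyEq ?_).deriv
  filter_upwards [hJ.mem_nhds ht] with s hs
  rw [hflow.harnackOf_eq hJ he hJT hl hv hs hx, harnackIn_sub T g γ φ α (taylor α t)]
  rfl

lemma adjointHeatIn_harnackOf
    (hw : DifferentiableAt ℝ (fun s => harnackIn T g γ φ (taylor α t) l e s x) t)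
    (hE : DifferentiableAt ℝ
      (fun s => (T - s) * energyIn (g s) γ (φ s) e x * kernelOf n T l s x) t) :
    adjointHeatIn g γ φ α e (harnackOf T g γ φ α l) t x =
      adjointHeatIn g γ φ α e (harnackIn T g γ φ (taylor α t) l e) t x := by
  have value : Set.EqOn (harnackOf T g γ φ α l t) (harnackIn T g γ φ (taylor α t) l e t)
      e.source := fun y hy => by
    rw [hflow.harnackOf_eq hJ he hJT hl hv ht hy, harnackIn_sub T g γ φ α (taylor α t),
      taylor_self, sub_self, zero_mul, sub_zero]
  rw [adjointHeatIn, adjointHeatIn, hflow.deriv_harnackOf_eq hJ he hJT hl hv ht hx hw hE,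
    laplacianIn_congr (g t) value hx, value hx]

end Harnack

end IsSignedHarmonicRicciFlow

end Flow

namespace IsSignedHarmonicRicciFlow

variable {n k : ℕ}
  {M : Type*} [TopologicalSpace M] [ChartedSpace (EuclideanSpace ℝ (Fin n)) M]
  [IsManifold (𝓡 n) ∞ M]
  {N : Type*} [TopologicalSpace N] [ChartedSpace (EuclideanSpace ℝ (Fin k)) N]
  [IsManifold (𝓡 k) ∞ N]
  {T : ℝ} {J : Set ℝ} {g : ℝ → RMetric n M} {γ : RMetric k N} {φ : ℝ → M → N} {α : ℝ → ℝ}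
  {l : ℝ → M → ℝ} {e : OpenPartialHomeomorph M (EuclideanSpace ℝ (Fin n))}
  {e' : OpenPartialHomeomorph N (EuclideanSpace ℝ (Fin k))}
  (hflow : IsSignedHarmonicRicciFlow J g γ φ α) (hJ : IsOpen J) (he : e ∈ charts n M)
  {Ω : Opens (ℝ × EuclideanSpace ℝ (Fin n))}
  (hΩ : (Ω : Set (ℝ × EuclideanSpace ℝ (Fin n))) ⊆ J ×ˢ e.target)
  (hφ : IsMapFamily Ω φ e e') {t : ℝ} {β σ c L v : SmoothFun Ω}
  (hβ : Rep β fun s _ => taylor α t s) (hσ : Rep σ fun s _ => T - s)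
  (hL : Rep L fun s u => l s (e.symm u)) (hv : Rep v fun s u => kernelOf n T l s (e.symm u))
  {u : EuclideanSpace ℝ (Fin n)} (hu : (t, u) ∈ Ω)
include hflow hJ he hΩ hφ hβ hσ hL hv hu

lemma differentiableAt_harnackIn :
    DifferentiableAt ℝ (fun s => harnackIn T g γ φ (taylor α t) l e s (e.symm u)) t :=
  ((hφ.rep_harnack γ (hflow.isMetricFamily he hΩ) (fun _ hq => (hΩ hq).2)
    (fun _ => hflow.mdifferentiableAt_map hJ he hΩ) hβ hL hσ hv).hasDerivAt
      ⟨(t, u), hu⟩).differentiableAt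

omit hβ hL in
lemma differentiableAt_energy : DifferentiableAt ℝ
    (fun s => (T - s) * energyIn (g s) γ (φ s) e (e.symm u) * kernelOf n T l s (e.symm u)) t :=
  (((hσ.mul (hφ.rep_energy γ (hflow.isMetricFamily he hΩ) (fun _ hq => (hΩ hq).2)
    (fun _ => hflow.mdifferentiableAt_map hJ he hΩ))).mul hv).hasDerivAt
      ⟨(t, u), hu⟩).differentiableAt

lemma adjointHeatIn_harnackIn (hJT : J ⊆ Set.Iio T) (ht : t ∈ J)
    (hc : Rep c fun s _ => 1 / (2 * (T - s)))
    (heat : ∀ x ∈ e.source, adjointHeatIn g γ φ α e (kernelOf n T l) t x = 0) :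
    adjointHeatIn g γ φ α e (harnackIn T g γ φ (taylor α t) l e) t (e.symm u) =
      -(2 * (T - t) *
          (solitonTensorSq (g t) γ (φ t) (α t) (l t) (T - t) e (e.symm u)
            + α t * solitonMapSq (g t) γ (φ t) (l t) e e' (e.symm u))
        - (T - t) * deriv α t * energyIn (g t) γ (φ t) e (e.symm u)) *
          kernelOf n T l t (e.symm u) := by
  have hG := hflow.isMetricFamily he hΩ
  have hd (q) := hflow.mdifferentiableAt_map hJ he hΩ (q := q)
  have htarget (q) (hq : q ∈ Ω) := (hΩ hq).2
  have slice_heat : slice Ω t (hG.coordMetric.adjointHeat (hφ.coordMap γ) β Dt v) = 0 :=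
    funext fun z => (hflow.adjointHeat_apply hJ he hΩ hφ ht hβ hv z.2).trans
      (heat _ (e.map_target (hΩ z.2).2))
  have identity := (hflow.isFlow hJ he hΩ hφ ht hβ).map_adjointHeat_harnack
    (hG.isKernel (fun q hq => hJT (hΩ hq).1) hL hv hσ hc) slice_heat
  have two : Rep (2 : SmoothFun Ω) fun _ _ => 2 := fun _ => rfl
  have rate : Rep (Dt β) fun _ _ => deriv α t := fun p =>
    (hβ.hasDerivAt p).unique (hasDerivAt_taylor α t p.1.1)
  have right_side := (((((two.mul hσ).mul
    ((hφ.rep_solitonTensorSq γ hG htarget hd hβ hL hc).add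
      (hβ.mul (hφ.rep_solitonMapSq γ hG htarget hL)))).sub
    ((hσ.mul rate).mul (hφ.rep_energy γ hG htarget hd))).neg).mul hv) ⟨(t, u), hu⟩
  simp only [taylor_self] at right_side
  exact (hflow.adjointHeat_apply hJ he hΩ hφ ht hβ
    (hφ.rep_harnack γ hG htarget hd hβ hL hσ hv) hu).symm.trans
      ((congrFun identity ⟨u, hu⟩).trans right_side)

end IsSignedHarmonicRicciFlow

end HarmonicRicci

end

theorem mainTheorem10_general {n k : ℕ}
    {M : Type*} [TopologicalSpace M] [ChartedSpace (EuclideanSpace ℝ (Fin n)) M]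
    [IsManifold (𝓡 n) ∞ M]
    {N : Type*} [TopologicalSpace N] [ChartedSpace (EuclideanSpace ℝ (Fin k)) N]
    [IsManifold (𝓡 k) ∞ N]
    (T : ℝ) (J : Set ℝ) (hJ : IsOpen J) (hJT : J ⊆ Set.Iio T)
    (g : ℝ → RMetric n M) (γ : RMetric k N) (φ : ℝ → M → N) (α : ℝ → ℝ)
    (hflow : IsSignedHarmonicRicciFlow J g γ φ α)
    (l : ℝ → M → ℝ)
    (hl : ContMDiffOn (𝓘(ℝ, ℝ).prod (𝓡 n)) 𝓘(ℝ, ℝ) ∞ (fun p : ℝ × M => l p.1 p.2)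
      (J ×ˢ Set.univ))
    (hv : ∀ t ∈ J, ∀ e ∈ charts n M, ∀ x ∈ e.source,
      adjointHeatIn g γ φ α e (kernelOf n T l) t x = 0) :
    ∀ t ∈ J, ∀ e ∈ charts n M, ∀ e' ∈ charts k N, ∀ x ∈ e.source, φ t x ∈ e'.source →
      adjointHeatIn g γ φ α e (harnackOf T g γ φ α l) t x =
        -2 * (T - t) *
          (solitonTensorSq (g t) γ (φ t) (α t) (l t) (T - t) e x
            + α t * solitonMapSq (g t) γ (φ t) (l t) e e' x
            - (1 / 2) * deriv α t * energyIn (g t) γ (φ t) e x) *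
          kernelOf n T l t x := by
  intro t ht e he e' he' x hx hφx
  obtain ⟨u, hu, rfl⟩ : ∃ u ∈ e.target, e.symm u = x :=
    ⟨e x, e.map_source hx, e.left_inv hx⟩
  have hΩ : (hflow.domain hJ he e' : Set (ℝ × EuclideanSpace ℝ (Fin n))) ⊆ J ×ˢ e.target :=
    Set.inter_subset_left
  have huΩ : (t, u) ∈ hflow.domain hJ he e' := ⟨⟨ht, hu⟩, hφx⟩
  have hφ := hflow.isMapFamily_domain hJ he he'
  have hT (q) (hq : q ∈ hflow.domain hJ he e') : q.1 < T := hJT (hΩ hq).1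
  have l_smooth := (contMDiffOn_inChart he hl).contDiffOn.mono hΩ
  have hL := rep_mk (F := fun s u => l s (e.symm u)) l_smooth
  have hK := rep_mk (kernelOf_contDiffOn (F := fun s u => l s (e.symm u)) hT l_smooth)
  have hβ := rep_mk (Ω := hflow.domain hJ he e') (F := fun s _ => taylor α t s)
    ((contDiff_taylor α t).comp contDiff_fst).contDiffOn
  have hσ := rep_mk (Ω := hflow.domain hJ he e') (F := fun s _ => T - s)
    (contDiff_const.sub contDiff_fst).contDiffOn
  have hc := rep_mk (F := fun s _ => 1 / (2 * (T - s))) (inv_two_mul_time_contDiffOn hT)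
  rw [hflow.adjointHeatIn_harnackOf hJ he hJT hl hv ht hx
      (hflow.differentiableAt_harnackIn hJ he hΩ hφ hβ hσ hL hK huΩ)
      (hflow.differentiableAt_energy hJ he hΩ hφ hσ hK huΩ),
    hflow.adjointHeatIn_harnackIn hJ he hΩ hφ hβ hσ hL hK huΩ hJT ht hc (hv t ht e he)]
  ring

theorem mainTheorem10 {n k : ℕ}
    {M : Type*} [TopologicalSpace M] [ChartedSpace (EuclideanSpace ℝ (Fin n)) M]
    [IsManifold (𝓡 n) ∞ M]
    {N : Type*} [TopologicalSpace N] [ChartedSpace (EuclideanSpace ℝ (Fin k)) N]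
    [IsManifold (𝓡 k) ∞ N]
    (T : ℝ) (J : Set ℝ) (hJ : IsOpen J) (hJT : J ⊆ Set.Iio T)
    (g : ℝ → RMetric n M) (γ : RMetric k N) (φ : ℝ → M → N) (α : ℝ → ℝ)
    (hflow : IsHarmonicRicciFlow J g γ φ α)
    (l : ℝ → M → ℝ)
    (hl : ContMDiffOn (𝓘(ℝ, ℝ).prod (𝓡 n)) 𝓘(ℝ, ℝ) ∞ (fun p : ℝ × M => l p.1 p.2)
      (J ×ˢ Set.univ))
    (hv : ∀ t ∈ J, ∀ e ∈ charts n M, ∀ x ∈ e.source,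
      adjointHeatIn g γ φ α e (kernelOf n T l) t x = 0) :
    ∀ t ∈ J, ∀ e ∈ charts n M, ∀ e' ∈ charts k N, ∀ x ∈ e.source, φ t x ∈ e'.source →
      adjointHeatIn g γ φ α e (harnackOf T g γ φ α l) t x =
        -2 * (T - t) *
          (solitonTensorSq (g t) γ (φ t) (α t) (l t) (T - t) e x
            + α t * solitonMapSq (g t) γ (φ t) (l t) e e' x
            - (1 / 2) * deriv α t * energyIn (g t) γ (φ t) e x) *
          kernelOf n T l t x :=
  mainTheorem10_general T J hJ hJT g γ φ α hflow.isSigned l hl hv
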